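/- Let $\Lambda\subseteq\mathbb R^d$ be a lattice (a discrete additive subgroup) or a vector subspace over a subfield of $\mathbb R$. A $\Lambda$-polytope is the convex hull of a finite subset of $\Lambda$ (the empty set is allowed). Let $G$ be an abelian group and let $\phi$ be a $\Lambda$-valuation with values in $G$, that is, a map from the set of $\Lambda$-polytopes to $G$ with $\phi(\emptyset)=0$, with $\phi(P\cup Q)=\phi(P)+\phi(Q)-\phi(P\cap Q)$ whenever $P,Q,P\cup Q,P\cap Q$ are $\Lambda$-polytopes, and with $\phi(P+t)=\phi(P)$ for all $\Lambda$-polytopes $P$ and all $t\in\Lambda$. For $r\ge 0$ and nonempty $\Lambda$-polytopes $P_1,\dots,P_r$ put $$\mathrm{CM}_r\phi(P_1,\dots,P_r)=\sum_{I\subseteq\{1,\dots,r\}}(-1)^{r-|I|}\,\phi\Big(\sum_{i\in I}P_i\Big),$$ with Minkowski sums, the empty sum being $\{0\}$. (a) For all $r\ge0$ and all nonempty $\Lambda$-polytopes $P_1,\dots,P_r$, the function $(n_1,\dots,n_r)\mapsto\phi(n_1P_1+\cdots+n_rP_r)$ on $\mathbb Z_{\ge0}^r$ is a polynomial: there is exactly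 one finitely supported family $(c_\alpha)_{\alpha\in\mathbb Z_{\ge0}^r}$ in $G$ such that $$\phi(n_1P_1+\cdots+n_rP_r)=\sum_{\alpha}\binom{n_1}{\alpha_1}\cdots\binom{n_r}{\alpha_r}\,c_\alpha\qquad\text{for all }n\in\mathbb Z_{\ge0}^r.$$ The coefficient $c_{(1,\dots,1)}$ of $\binom{n_1}{1}\cdots\binom{n_r}{1}$ is equal to $\mathrm{CM}_r\phi(P_1,\dots,P_r)$. (b) If $r>d$, then $\mathrm{CM}_r\phi(P_1,\dots,P_r)=0$ for all nonempty $\Lambda$-polytopes $P_1,\dots,P_r$. -/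

import Mathlib

open scoped Pointwise

namespace CombMixed

variable {d : ℕ}

/-- The admissible groups `Λ ⊆ ℝᵈ`: lattices (discrete additive subgroups, not necessarily of full
rank) and vector subspaces over a subfield of `ℝ`. -/
def IsLatticeOrSubspace (L : AddSubgroup (Fin d → ℝ)) : Prop :=
  DiscreteTopology L ∨ ∃ F : Subfield ℝ, ∀ a ∈ F, ∀ x ∈ L, a • x ∈ L

/-- A `Λ`-polytope: a polytope with vertices in `Λ`, i.e. the convex hull of a finite subset
of `Λ`. The empty set is included. -/
def IsLPolytope (L : AddSubgroup (Fin d → ℝ)) (P : Set (Fin d → ℝ)) : Prop :=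
  ∃ V : Set (Fin d → ℝ), V.Finite ∧ V ⊆ (L : Set (Fin d → ℝ)) ∧ P = convexHull ℝ V

/-- The collection of all `Λ`-polytopes. -/
def LPolytope (L : AddSubgroup (Fin d → ℝ)) : Type :=
  {P : Set (Fin d → ℝ) // IsLPolytope L P}

theorem IsLPolytope.zero (L : AddSubgroup (Fin d → ℝ)) : IsLPolytope L 0 := by
  refine ⟨{0}, Set.finite_singleton _, ?_, ?_⟩
  · simp
  · rw [convexHull_singleton]; rfl

theorem IsLPolytope.add {L : AddSubgroup (Fin d → ℝ)} {P Q : Set (Fin d → ℝ)}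
    (hP : IsLPolytope L P) (hQ : IsLPolytope L Q) : IsLPolytope L (P + Q) := by
  obtain ⟨V, hV, hVL, rfl⟩ := hP
  obtain ⟨W, hW, hWL, rfl⟩ := hQ
  refine ⟨V + W, hV.add hW, ?_, (convexHull_add V W).symm⟩
  rintro _ ⟨v, hv, w, hw, rfl⟩
  exact L.add_mem (hVL hv) (hWL hw)

theorem IsLPolytope.sum {L : AddSubgroup (Fin d → ℝ)} {ι : Type*} (I : Finset ι)
    (P : ι → Set (Fin d → ℝ)) (hP : ∀ i ∈ I, IsLPolytope L (P i)) :
    IsLPolytope L (∑ i ∈ I, P i) :=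
  Finset.sum_induction P (IsLPolytope L) (fun _ _ => IsLPolytope.add) (IsLPolytope.zero L) hP

theorem IsLPolytope.natDilate {L : AddSubgroup (Fin d → ℝ)} {P : Set (Fin d → ℝ)}
    (hP : IsLPolytope L P) (n : ℕ) : IsLPolytope L ((n : ℝ) • P) := by
  obtain ⟨V, hV, hVL, rfl⟩ := hP
  refine ⟨(n : ℝ) • V, hV.smul_set, ?_, (convexHull_smul (n : ℝ) V).symm⟩
  rintro _ ⟨v, hv, rfl⟩
  simpa [Nat.cast_smul_eq_nsmul] using L.nsmul_mem (hVL hv) n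

/-- The Minkowski sum `P_I = ∑_{i ∈ I} P_i`; for `I = ∅` this is `{0}`. -/
def minkowskiSum {L : AddSubgroup (Fin d → ℝ)} {r : ℕ} (P : Fin r → LPolytope L)
    (I : Finset (Fin r)) : LPolytope L :=
  ⟨∑ i ∈ I, (P i).1, IsLPolytope.sum I _ fun i _ => (P i).2⟩

/-- The `Λ`-polytope `n₁P₁ + ⋯ + nᵣPᵣ`, where `nP = {n x : x ∈ P}`. -/
def natComb {L : AddSubgroup (Fin d → ℝ)} {r : ℕ} (P : Fin r → LPolytope L)
    (n : Fin r → ℕ) : LPolytope L :=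
  ⟨∑ i, (n i : ℝ) • (P i).1, IsLPolytope.sum _ _ fun i _ => (P i).2.natDilate (n i)⟩

/-- `φ` is a `Λ`-valuation: a `Λ`-translation-invariant valuation on `Λ`-polytopes. -/
structure IsLValuation {L : AddSubgroup (Fin d → ℝ)} {G : Type*} [AddCommGroup G]
    (φ : LPolytope L → G) : Prop where
  empty : ∀ P : LPolytope L, P.1 = ∅ → φ P = 0
  union : ∀ P Q U D : LPolytope L, U.1 = P.1 ∪ Q.1 → D.1 = P.1 ∩ Q.1 →
    φ U = φ P + φ Q - φ D
  translate : ∀ P Q : LPolytope L, ∀ t ∈ L, Q.1 = (fun x => x + t) '' P.1 → φ Q = φ P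

/-- The `r`-th combinatorial mixed valuation `CM_r φ`. -/
def CM {L : AddSubgroup (Fin d → ℝ)} {G : Type*} [AddCommGroup G] (φ : LPolytope L → G)
    {r : ℕ} (P : Fin r → LPolytope L) : G :=
  ∑ I : Finset (Fin r), (-1 : ℤ) ^ (r - I.card) • φ (minkowskiSum P I)

/-- The finitely supported family `c` is a family of coefficients of `f : ℕʳ → G` in the binomial
basis: `f(n) = ∑_α C(n₁,α₁)⋯C(nᵣ,αᵣ) c_α` for all `n`. -/
def IsBinomialExpansion {G : Type*} [AddCommGroup G] {r : ℕ} (f : (Fin r → ℕ) → G)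
    (c : (Fin r → ℕ) →₀ G) : Prop :=
  ∀ n : Fin r → ℕ, f n = c.sum fun α g => (∏ i, (n i).choose (α i)) • g

end CombMixed

/-! Two facts carry the theorem: a Λ-valuation inherits every linear relation between indicator
functions of Λ-polytopes (`IsLValuation.sum_eq_zero`), and mixed valuations of more than d polytopes
vanish (`IsLValuation.mixedValue_eq_zero`).

Both rest on Radon relations. If Σ_{t∈T} u_t v_t = 0 and the set B of all t with u_t > 0 is
nonempty, then Σ_{S⊆B} (-1)^|S| [cone(T \ S)] = 0 (`altSum_coneInd`). For full additivity, polytopes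
are replaced by the cones over them at height one. Radon relations generate all relations between
the cones spanned by subfamilies of a pointed family (`mem_radonSpan_of_coneEval`). A valuation
satisfies all of them (`IsWeaklyAdditive.altSum_eq_zero`): with at most two positive coefficients
they are instances of the valuation property, and the others reduce to these by adding points of Λ
on rays through two given points.

For the vanishing, colour the generating points of P_i by i and apply the Cayley embedding into
ℝ^(d+r). The fibres of the resulting cones over 0/1 vectors are Minkowski sums, so Radon relations
of Cayley vectors become relations between mixed valuations. If r > d and each colour has at least
two points, then at least 2r > d + r vectors are present, hence dependent, and the mixed value is a
combination of mixed values of smaller point sets in which every colour survives. Once a colour has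
a single point, translation invariance gives zero.

For polynomiality, the mixed difference of order α at the origin is the mixed valuation in which P_i
is repeated α_i times. It vanishes when |α| > d, so Newton's expansion is finite. Its coefficients
are forced, and the one at (1,…,1) is `CM`. -/

open scoped Pointwise

namespace CombMixed

/-! ### Alternating sums over deleted subsets -/

section AltSum

variable {ι G : Type*} [DecidableEq ι] [AddCommGroup G]

/-- The alternating sum of `Ψ (T \ S)` over all subsets `S` of `B`. -/
def altSum (Ψ : Finset ι → G) (T B : Finset ι) : G :=
  ∑ S ∈ B.powerset, (-1 : ℤ) ^ S.card • Ψ (T \ S)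

theorem altSum_empty (Ψ : Finset ι → G) (T : Finset ι) : altSum Ψ T ∅ = Ψ T := by
  simp [altSum]

theorem altSum_insert (Ψ : Finset ι → G) (T : Finset ι) {B : Finset ι} {b : ι} (hb : b ∉ B) :
    altSum Ψ T (insert b B) = altSum Ψ T B - altSum Ψ (T.erase b) B := by
  unfold altSum
  rw [Finset.sum_powerset_insert hb, sub_eq_add_neg, ← Finset.sum_neg_distrib]
  congr 1
  refine Finset.sum_congr rfl fun S hS => ?_
  have hbS : b ∉ S := fun h => hb (Finset.mem_powerset.1 hS h)
  have : T \ insert b S = T.erase b \ S := by ext x; simp; tauto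
  rw [Finset.card_insert_of_notMem hbS, this, pow_succ]
  simp

theorem altSum_singleton (Ψ : Finset ι → G) (T : Finset ι) (b : ι) :
    altSum Ψ T {b} = Ψ T - Ψ (T.erase b) := by
  have := altSum_insert Ψ T (Finset.notMem_empty b)
  simpa [altSum_empty] using this

theorem altSum_pair (Ψ : Finset ι → G) (T : Finset ι) {a b : ι} (h : a ≠ b) :
    altSum Ψ T {a, b} = Ψ T - Ψ (T.erase b) - (Ψ (T.erase a) - Ψ ((T.erase a).erase b)) := by
  rw [altSum_insert Ψ T (by simpa using h), altSum_singleton, altSum_singleton]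

theorem map_altSum {G' : Type*} [AddCommGroup G'] (f : G →+ G') (Ψ : Finset ι → G)
    (T B : Finset ι) : f (altSum Ψ T B) = altSum (fun T => f (Ψ T)) T B := by
  simp [altSum, map_sum, map_zsmul]

theorem altSum_congr {Ψ Φ : Finset ι → G} {T U B : Finset ι}
    (h : ∀ S ⊆ B, Ψ (T \ S) = Φ (U \ S)) : altSum Ψ T B = altSum Φ U B :=
  Finset.sum_congr rfl fun S hS => by rw [h S (Finset.mem_powerset.1 hS)]

theorem altSum_add (Ψ Φ : Finset ι → G) (T B : Finset ι) :
    altSum (fun T => Ψ T + Φ T) T B = altSum Ψ T B + altSum Φ T B := by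
  simp [altSum, Finset.sum_add_distrib]

theorem altSum_sub (Ψ Φ : Finset ι → G) (T B : Finset ι) :
    altSum (fun T => Ψ T - Φ T) T B = altSum Ψ T B - altSum Φ T B := by
  simp [altSum, smul_sub]

theorem altSum_erase (Ψ : Finset ι → G) (T B : Finset ι) (c : ι) :
    altSum (fun T => Ψ (T.erase c)) T B = altSum Ψ (T.erase c) B := by
  refine Finset.sum_congr rfl fun S _ => ?_
  have : (T \ S).erase c = T.erase c \ S := by ext x; simp; tauto
  simp only [this]

end AltSum

/-! ### Finitely generated cones and their Radon relations -/

section Cone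

variable {ι E : Type*} [AddCommGroup E] [Module ℝ E]

/-- `y` is a nonnegative combination of the vectors `v t`, `t ∈ T`. -/
def InCone (v : ι → E) (T : Finset ι) (y : E) : Prop :=
  ∃ c : ι → ℝ, (∀ t ∈ T, 0 ≤ c t) ∧ ∑ t ∈ T, c t • v t = y

theorem InCone.mono {v : ι → E} {T T' : Finset ι} {y : E} (h : InCone v T y) (hT : T ⊆ T') :
    InCone v T' y := by
  classical
  obtain ⟨c, hc, rfl⟩ := h
  refine ⟨fun t => if t ∈ T then c t else 0, fun t _ => ?_, ?_⟩
  · dsimp only; split_ifs with h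
    exacts [hc t h, le_rfl]
  · simp only [ite_smul, zero_smul]
    rw [Finset.sum_ite_mem, Finset.inter_eq_right.2 hT]

theorem InCone.add {v : ι → E} {T : Finset ι} {x y : E} (hx : InCone v T x)
    (hy : InCone v T y) : InCone v T (x + y) := by
  obtain ⟨a, ha, rfl⟩ := hx
  obtain ⟨b, hb, rfl⟩ := hy
  exact ⟨fun t => a t + b t, fun t ht => add_nonneg (ha t ht) (hb t ht), by
    simp [add_smul, Finset.sum_add_distrib]⟩

theorem InCone.smul {v : ι → E} {T : Finset ι} {x : E} (hx : InCone v T x) {r : ℝ}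
    (hr : 0 ≤ r) : InCone v T (r • x) := by
  obtain ⟨a, ha, rfl⟩ := hx
  exact ⟨fun t => r * a t, fun t ht => mul_nonneg hr (ha t ht), by
    simp [mul_smul, Finset.smul_sum]⟩

theorem InCone.zero (v : ι → E) (T : Finset ι) : InCone v T 0 := ⟨0, by simp, by simp⟩

theorem InCone.of_mem {v : ι → E} {T : Finset ι} {t : ι} (ht : t ∈ T) : InCone v T (v t) := by
  classical
  exact ⟨Pi.single t 1, fun s _ => by by_cases h : s = t <;> simp [h], by
    simp [Pi.single_apply, ite_smul, ht]⟩

theorem InCone.sum {κ : Type*} {v : ι → E} {T : Finset ι} {s : Finset κ} {x : κ → E}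
    (h : ∀ k ∈ s, InCone v T (x k)) : InCone v T (∑ k ∈ s, x k) :=
  Finset.sum_induction x (InCone v T) (fun _ _ => InCone.add) (InCone.zero v T) h

theorem InCone.congr {v w : ι → E} {T : Finset ι} (h : ∀ t ∈ T, v t = w t) (y : E) :
    InCone v T y ↔ InCone w T y := by
  refine exists_congr fun c => and_congr Iff.rfl ?_
  rw [Finset.sum_congr rfl fun t ht => by rw [h t ht]]

theorem InCone.trans {κ : Type*} {v : ι → E} {w : κ → E} {T : Finset ι} {U : Finset κ} {y : E}
    (hy : InCone v T y) (h : ∀ t ∈ T, InCone w U (v t)) : InCone w U y := by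
  obtain ⟨c, hc, rfl⟩ := hy
  exact InCone.sum fun t ht => (h t ht).smul (hc t ht)

theorem inCone_insert [DecidableEq ι] {v : ι → E} {T : Finset ι} {b : ι} (hb : b ∉ T) {y : E} :
    InCone v (insert b T) y ↔ ∃ r : ℝ, 0 ≤ r ∧ InCone v T (y - r • v b) := by
  constructor
  · rintro ⟨c, hc, rfl⟩
    refine ⟨c b, hc b (by simp), c, fun t ht => hc t (by simp [ht]), ?_⟩
    rw [Finset.sum_insert hb]; abel
  · rintro ⟨r, hr, h⟩
    have h1 := (InCone.of_mem (v := v) (Finset.mem_insert_self b T)).smul hr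
    simpa using h1.add (h.mono (Finset.subset_insert b T))

/-- The family `u` is a linear dependence of the vectors `v t`, `t ∈ T`, and `B` is the set of
indices in `T` with positive coefficient. -/
structure IsDep (v : ι → E) (T B : Finset ι) (u : ι → ℝ) : Prop where
  sub : B ⊆ T
  pos : ∀ t ∈ B, 0 < u t
  nonpos : ∀ t ∈ T, t ∉ B → u t ≤ 0
  dep : ∑ t ∈ T, u t • v t = 0

open Classical in
/-- Indicator function of the cone spanned by the `v t`, `t ∈ T`. -/
noncomputable def coneInd (v : ι → E) (y : E) (T : Finset ι) : ℤ := if InCone v T y then 1 else 0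

theorem InCone.convexComb {v : ι → E} {T : Finset ι} {y : E} {a b : ℝ} (ha : 0 ≤ a) (hb : 0 ≤ b)
    (hab : 0 < a + b) (h : InCone v T ((a + b) • y)) : InCone v T y := by
  have := h.smul (inv_nonneg.2 (add_nonneg ha hb))
  rwa [smul_smul, inv_mul_cancel₀ hab.ne', one_smul] at this

theorem coneInd_eq_of_iff {κ F : Type*} [AddCommGroup F] [Module ℝ F] {v : ι → E} {w : κ → F}
    {T : Finset ι} {U : Finset κ} {y : E} {z : F} (h : InCone v T y ↔ InCone w U z) :
    coneInd v y T = coneInd w z U := by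
  unfold coneInd
  by_cases hy : InCone v T y
  · rw [if_pos hy, if_pos (h.1 hy)]
  · rw [if_neg hy, if_neg (mt h.2 hy)]

theorem coneInd_eq_of_union {v v₁ v₂ v₃ : ι → E} {T T₁ T₂ T₃ : Finset ι} {y : E}
    (h : InCone v T y ↔ InCone v₁ T₁ y ∨ InCone v₂ T₂ y)
    (h' : InCone v₃ T₃ y ↔ InCone v₁ T₁ y ∧ InCone v₂ T₂ y) :
    coneInd v y T = coneInd v₁ y T₁ + coneInd v₂ y T₂ - coneInd v₃ y T₃ := by
  unfold coneInd
  by_cases h1 : InCone v₁ T₁ y <;> by_cases h2 : InCone v₂ T₂ y <;> simp [h, h', h1, h2]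

/-- Merging two generators into a positive combination of them. -/
theorem coneInd_merge [DecidableEq ι] (v : ι → E) (y : E) {T : Finset ι} {b c : ι} (hbc : b ≠ c)
    (hb : b ∉ T) (hc : c ∉ T) {β γ : ℝ} (hβ : 0 < β) (hγ : 0 < γ) :
    coneInd v y (insert b (insert c T)) =
      coneInd (Function.update v b (β • v b + γ • v c)) y (insert b (insert c T)) +
      coneInd (Function.update v c (β • v b + γ • v c)) y (insert b (insert c T)) -
      coneInd (Function.update v b (β • v b + γ • v c)) y (insert b T) := by
  set p := β • v b + γ • v c with hp
  have hbT : b ∉ insert c T := by simp [hbc, hb]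
  have hcT : c ∉ insert b T := by simp [hbc.symm, hc]
  have e0 : ∀ (w : ι → E) (z : E), (∀ t ∈ T, w t = v t) → (InCone w T z ↔ InCone v T z) :=
    fun w z h => InCone.congr h z
  have hT1 : ∀ t ∈ T, Function.update v b p t = v t := fun t ht => by
    rw [Function.update_of_ne]; rintro rfl; exact hb ht
  have hT2 : ∀ t ∈ T, Function.update v c p t = v t := fun t ht => by
    rw [Function.update_of_ne]; rintro rfl; exact hc ht
  have A0 : InCone v (insert b (insert c T)) y ↔
      ∃ r : ℝ, 0 ≤ r ∧ ∃ s : ℝ, 0 ≤ s ∧ InCone v T (y - r • v b - s • v c) := by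
    simp [inCone_insert, hbT, hc]
  have A1 : InCone (Function.update v b p) (insert b (insert c T)) y ↔
      ∃ r : ℝ, 0 ≤ r ∧ ∃ s : ℝ, 0 ≤ s ∧ InCone v T (y - r • p - s • v c) := by
    simp [inCone_insert, hbT, hc, e0 _ _ hT1, Function.update_of_ne hbc.symm]
  have A2 : InCone (Function.update v c p) (insert b (insert c T)) y ↔
      ∃ r : ℝ, 0 ≤ r ∧ ∃ s : ℝ, 0 ≤ s ∧ InCone v T (y - r • v b - s • p) := by
    simp [inCone_insert, hbT, hc, e0 _ _ hT2, Function.update_of_ne hbc]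
  have A3 : InCone (Function.update v b p) (insert b T) y ↔
      ∃ r : ℝ, 0 ≤ r ∧ InCone v T (y - r • p) := by
    simp [inCone_insert, hb, e0 _ _ hT1]
  have B1 : InCone (Function.update v b p) (insert b T) y →
      InCone (Function.update v b p) (insert b (insert c T)) y :=
    fun h => h.mono (Finset.insert_subset_insert _ (Finset.subset_insert _ _))
  have B2 : InCone (Function.update v b p) (insert b T) y →
      InCone (Function.update v c p) (insert b (insert c T)) y := by
    rw [A3, A2]
    rintro ⟨r, hr, h⟩
    exact ⟨0, le_rfl, r, hr, by simpa using h⟩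
  have B3 : InCone (Function.update v b p) (insert b (insert c T)) y →
      InCone v (insert b (insert c T)) y := by
    rw [A1, A0]
    rintro ⟨r, hr, s, hs, h⟩
    refine ⟨r * β, by positivity, r * γ + s, by positivity, ?_⟩
    convert h using 1
    rw [hp]; module
  have B4 : InCone (Function.update v c p) (insert b (insert c T)) y →
      InCone v (insert b (insert c T)) y := by
    rw [A2, A0]
    rintro ⟨r, hr, s, hs, h⟩
    refine ⟨r + s * β, by positivity, s * γ, by positivity, ?_⟩
    convert h using 1
    rw [hp]; module
  have B5 : InCone v (insert b (insert c T)) y →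
      InCone (Function.update v b p) (insert b (insert c T)) y ∨
      InCone (Function.update v c p) (insert b (insert c T)) y := by
    rw [A0, A1, A2]
    rintro ⟨r, hr, s, hs, h⟩
    -- In r • v b + s • v c, extract as much of p as possible. The smaller of r/β and s/γ decides
    -- which of the two generators is used up.
    rcases le_total (r * γ) (s * β) with hle | hle
    · left
      refine ⟨r / β, by positivity, s - r * γ / β, ?_, ?_⟩
      · rw [sub_nonneg, div_le_iff₀ hβ]; exact hle
      · convert h using 1
        have : r • v b = (r / β) • β • v b := by rw [smul_smul, div_mul_cancel₀ _ hβ.ne']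
        rw [hp, this]; module
    · right
      refine ⟨r - s * β / γ, ?_, s / γ, by positivity, ?_⟩
      · rw [sub_nonneg, div_le_iff₀ hγ]; exact hle
      · convert h using 1
        have : s • v c = (s / γ) • γ • v c := by rw [smul_smul, div_mul_cancel₀ _ hγ.ne']
        rw [hp, this]; module
  have B6 : InCone (Function.update v b p) (insert b (insert c T)) y →
      InCone (Function.update v c p) (insert b (insert c T)) y →
      InCone (Function.update v b p) (insert b T) y := by
    rw [A1, A2, A3]
    rintro ⟨r, hr, s, hs, h⟩ ⟨r', hr', s', hs', h'⟩
    rcases hs.eq_or_lt with rfl | hs0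
    · exact ⟨r, hr, by simpa using h⟩
    have hx : 0 < r' * γ + s * β := by positivity
    -- Average the two representations of y with weights r'γ and sβ: the leftover terms r'γ·s • v c
    -- and sβ·r' • v b then add up to s r' • p.
    refine ⟨(r' * γ * r + s * β * s' + s * r') / (r' * γ + s * β), by positivity, ?_⟩
    have key := (h.smul (show 0 ≤ r' * γ by positivity)).add (h'.smul (show 0 ≤ s * β by positivity))
    refine InCone.convexComb (a := r' * γ) (b := s * β) (by positivity) (by positivity) hx ?_
    convert key using 1
    rw [smul_sub, smul_smul, mul_div_cancel₀ _ hx.ne', hp]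
    module
  exact coneInd_eq_of_union ⟨B5, fun h => h.elim B3 B4⟩ ⟨fun h => ⟨B1 h, B2 h⟩, fun h => B6 h.1 h.2⟩

theorem coneInd_congr {v w : ι → E} {T : Finset ι} (h : ∀ t ∈ T, v t = w t) (y : E) :
    coneInd v y T = coneInd w y T :=
  coneInd_eq_of_iff (InCone.congr h y)

/-- Induction on the number of positive coefficients. If b is the only one, v b lies in the cone of
the other vectors, so deleting it changes nothing. Otherwise two positive terms are merged into p =
u b • v b + u c • v c, which leaves dependences with one positive coefficient fewer; `coneInd_merge`
relates the cones before and after. -/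
theorem altSum_coneInd [DecidableEq ι] (y : E) (n : ℕ) : ∀ (v : ι → E) (T B : Finset ι) (u : ι → ℝ),
    IsDep v T B u → B.card = n + 1 → altSum (coneInd v y) T B = 0 := by
  induction n with
  | zero =>
    intro v T B u h hB
    obtain ⟨b, rfl⟩ := Finset.card_eq_one.1 hB
    have hbT : b ∈ T := h.sub (by simp)
    have hb := h.pos b (by simp)
    have hbc : InCone v (T.erase b) (v b) := by
      refine ⟨fun t => (u b)⁻¹ * -u t, fun t ht => ?_, ?_⟩
      · have := h.nonpos t (Finset.mem_of_mem_erase ht) (by simpa using Finset.ne_of_mem_erase ht)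
        exact mul_nonneg (inv_nonneg.2 hb.le) (by linarith)
      · have h0 := h.dep
        rw [← Finset.add_sum_erase T _ hbT] at h0
        simp only [mul_smul, ← Finset.smul_sum, neg_smul, Finset.sum_neg_distrib]
        rw [← eq_neg_of_add_eq_zero_left h0, smul_smul, inv_mul_cancel₀ hb.ne', one_smul]
    rw [altSum_singleton, sub_eq_zero]
    have : InCone v T y ↔ InCone v (T.erase b) y := by
      refine ⟨fun hy => hy.trans fun t ht => ?_, fun hy => hy.mono (Finset.erase_subset b T)⟩
      by_cases htb : t = b
      · rw [htb]; exact hbc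
      · exact InCone.of_mem (Finset.mem_erase.2 ⟨htb, ht⟩)
    exact coneInd_eq_of_iff this
  | succ n ih =>
    intro v T B u h hB
    obtain ⟨b, B₁, hb₁, rfl, hB₁⟩ := Finset.card_eq_succ.1 hB
    obtain ⟨c, B', hc', rfl, hB'⟩ := Finset.card_eq_succ.1 hB₁
    have hbc : b ≠ c := fun e => hb₁ (by simp [e])
    have hb' : b ∉ B' := fun e => hb₁ (by simp [e])
    have hbT : b ∈ T := h.sub (by simp)
    have hcT : c ∈ T := h.sub (by simp)
    have hβ := h.pos b (by simp)
    have hγ := h.pos c (by simp)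
    set p := u b • v b + u c • v c with hp
    set v₁ := Function.update v b p with hv₁
    set v₂ := Function.update v c p with hv₂
    have hv₁' : ∀ t, t ≠ b → v₁ t = v t := fun t ht => Function.update_of_ne ht _ _
    have hv₂' : ∀ t, t ≠ c → v₂ t = v t := fun t ht => Function.update_of_ne ht _ _
    obtain ⟨R, hR, hbR, hcR⟩ : ∃ R, T = insert b (insert c R) ∧ b ∉ R ∧ c ∉ R :=
      ⟨(T.erase b).erase c, by
        rw [Finset.insert_erase (by simp [hbc.symm, hcT]), Finset.insert_erase hbT], by simp, by simp⟩
    have hB'R : B' ⊆ R := fun t ht => by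
      have : t ∈ T := h.sub (by simp [ht])
      rw [hR] at this
      simp only [Finset.mem_insert] at this
      rcases this with rfl | rfl | h
      exacts [absurd ht hb', absurd ht hc', h]
    have hbcR : b ∉ insert c R := by simp [hbc, hbR]
    have hdep : p + ∑ t ∈ R, u t • v t = 0 := by
      have := h.dep
      rw [hR, Finset.sum_insert hbcR, Finset.sum_insert hcR] at this
      rw [hp, add_assoc]; exact this
    have hRb : ∀ t ∈ R, t ≠ b := fun t ht e => hbR (e ▸ ht)
    have hRc : ∀ t ∈ R, t ≠ c := fun t ht e => hcR (e ▸ ht)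
    have hRn : ∀ t ∈ R, t ∉ B' → u t ≤ 0 := fun t ht htB =>
      h.nonpos t (by simp [hR, ht]) (by simp [htB, hRb t ht, hRc t ht])
    have hBp : ∀ t ∈ B', 0 < u t := fun t ht => h.pos t (by simp [ht])
    -- The index b (in v₁) or c (in v₂) now carries p, with coefficient 1. Where the other merged
    -- generator is still present, it gets coefficient 0.
    have d1 : IsDep v₁ (insert b R) (insert b B') (Function.update u b 1) := by
      refine ⟨Finset.insert_subset_insert _ hB'R, ?_, ?_, ?_⟩
      · simp only [Finset.forall_mem_insert]
        refine ⟨by simp, fun t ht => ?_⟩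
        rw [Function.update_of_ne (hRb t (hB'R ht))]; exact hBp t ht
      · intro t ht htB
        simp only [Finset.mem_insert, not_or] at ht htB
        rw [Function.update_of_ne htB.1]; exact hRn t (ht.resolve_left htB.1) htB.2
      · rw [Finset.sum_insert hbR, ← hdep]
        congr 1
        · simp [hv₁]
        · exact Finset.sum_congr rfl fun t ht => by
            rw [Function.update_of_ne (hRb t ht), hv₁' t (hRb t ht)]
    have d2 : IsDep v₁ (insert b (insert c R)) (insert b B')
        (Function.update (Function.update u b 1) c 0) := by
      refine ⟨d1.sub.trans (Finset.insert_subset_insert _ (Finset.subset_insert _ _)),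
        fun t ht => ?_, fun t ht htB => ?_, ?_⟩
      · have htc : t ≠ c := by rintro rfl; simp [hbc.symm, hc'] at ht
        rw [Function.update_of_ne htc]; exact d1.pos t ht
      · by_cases htc : t = c
        · subst htc; simp
        · rw [Function.update_of_ne htc]
          exact d1.nonpos t (by simpa [htc] using ht) htB
      · rw [Finset.insert_comm, Finset.sum_insert (by simp [hbc.symm, hcR])]
        simp only [Function.update_self, zero_smul, zero_add]
        rw [← d1.dep]
        refine Finset.sum_congr rfl fun t ht => ?_
        have htc : t ≠ c := by rintro rfl; simp [hbc.symm, hcR] at ht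
        rw [Function.update_of_ne htc]
    have d3 : IsDep v₂ (insert b (insert c R)) (insert c B')
        (Function.update (Function.update u c 1) b 0) := by
      refine ⟨?_, ?_, ?_, ?_⟩
      · exact (Finset.insert_subset_insert _ hB'R).trans (Finset.subset_insert _ _)
      · simp only [Finset.forall_mem_insert]
        refine ⟨by simp [hbc.symm], fun t ht => ?_⟩
        rw [Function.update_of_ne (hRb t (hB'R ht)), Function.update_of_ne (hRc t (hB'R ht))]
        exact hBp t ht
      · intro t ht htB
        simp only [Finset.mem_insert, not_or] at ht htB
        by_cases htb : t = b
        · simp [htb]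
        · have htR := (ht.resolve_left htb).resolve_left htB.1
          rw [Function.update_of_ne htb, Function.update_of_ne htB.1]
          exact hRn t htR htB.2
      · rw [Finset.sum_insert hbcR, Finset.sum_insert hcR, ← hdep]
        simp only [Function.update_self, zero_smul, zero_add]
        congr 1
        · rw [Function.update_of_ne hbc.symm]; simp [hv₂]
        · exact Finset.sum_congr rfl fun t ht => by
            rw [Function.update_of_ne (hRb t ht), Function.update_of_ne (hRc t ht),
              hv₂' t (hRc t ht)]
    have hTc : T.erase c = insert b R := by
      rw [hR, Finset.insert_comm, Finset.erase_insert (by simp [hbc.symm, hcR])]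
    have e1 := ih v₁ _ _ _ d1 (by rw [Finset.card_insert_of_notMem hb', hB'])
    have e2 := ih v₁ _ _ _ d2 (by rw [Finset.card_insert_of_notMem hb', hB'])
    have e3 := ih v₂ _ _ _ d3 (by rw [Finset.card_insert_of_notMem hc', hB'])
    rw [← hR] at e2 e3
    rw [← hTc] at e1
    rw [altSum_insert _ _ hb'] at e1 e2
    rw [altSum_insert _ _ hc'] at e3
    rw [altSum_insert _ _ hb₁, altSum_insert _ _ hc', altSum_insert _ _ hc']
    have m : altSum (coneInd v y) T B' = altSum (coneInd v₁ y) T B' + altSum (coneInd v₂ y) T B' -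
        altSum (coneInd v₁ y) (T.erase c) B' := by
      rw [← altSum_erase, ← altSum_add, ← altSum_sub]
      refine altSum_congr fun S hS => ?_
      have hbS : b ∉ S := fun e => hb' (hS e)
      have hcS : c ∉ S := fun e => hc' (hS e)
      have hTS : T \ S = insert b (insert c (R \ S)) := by
        rw [hR, Finset.insert_sdiff_of_notMem _ hbS, Finset.insert_sdiff_of_notMem _ hcS]
      have hTS' : (T \ S).erase c = insert b (R \ S) := by
        rw [hTS, Finset.insert_comm, Finset.erase_insert (by simp [hbc.symm, hcR])]
      rw [hTS', hTS]
      exact coneInd_merge v y hbc (by simp [hbR]) (by simp [hcR]) hβ hγ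
    have c1 : altSum (coneInd v₁ y) (T.erase b) B' = altSum (coneInd v y) (T.erase b) B' :=
      altSum_congr fun S _ => coneInd_congr (fun t ht => hv₁' t (by rintro rfl; simp at ht)) y
    have c2 : altSum (coneInd v₂ y) (T.erase c) B' = altSum (coneInd v y) (T.erase c) B' :=
      altSum_congr fun S _ => coneInd_congr (fun t ht => hv₂' t (by rintro rfl; simp at ht)) y
    have c3 : altSum (coneInd v₁ y) ((T.erase c).erase b) B' =
        altSum (coneInd v y) ((T.erase b).erase c) B' := by
      rw [Finset.erase_right_comm]
      exact altSum_congr fun S _ => coneInd_congr (fun t ht => hv₁' t (by rintro rfl; simp at ht)) y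
    rw [c1] at e2
    rw [c2] at e3
    rw [c3] at e1
    linarith

end Cone

/-! ### Extreme generators and localisation along a ray -/

section Localize

variable {ι E : Type*} [AddCommGroup E] [Module ℝ E]

/-- A linearly dependent family admits a dependence with a positive coefficient. -/
theorem exists_isDep {v : ι → E} {T : Finset ι} {f : ι → ℝ} (hf : ∑ t ∈ T, f t • v t = 0)
    {t₀ : ι} (ht₀ : t₀ ∈ T) (h0 : f t₀ ≠ 0) :
    ∃ B u, IsDep v T B u ∧ B.Nonempty := by
  classical
  wlog hpos : 0 < f t₀ generalizing f
  · refine this (f := fun t => -f t) (by simp [hf]) (by simpa using h0) ?_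
    rcases lt_or_gt_of_ne h0 with h | h
    · simpa using h
    · exact absurd h hpos
  refine ⟨T.filter fun t => 0 < f t, f, ⟨Finset.filter_subset _ _, fun t ht => ?_,
    fun t ht htB => ?_, hf⟩, ⟨t₀, by simp [ht₀, hpos]⟩⟩
  · exact (Finset.mem_filter.1 ht).2
  · simpa [ht] using htB

theorem IsDep.altSum_coneInd [DecidableEq ι] {v : ι → E} {T B : Finset ι} {u : ι → ℝ}
    (h : IsDep v T B u) (hB : B.Nonempty) (y : E) : altSum (coneInd v y) T B = 0 := by
  obtain ⟨n, hn⟩ := Nat.exists_eq_succ_of_ne_zero (Finset.card_pos.2 hB).ne'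
  exact CombMixed.altSum_coneInd y n v T B u h hn

/-- Carathéodory from Radon: in a Radon relation evaluated at y the term S = ∅ is 1, so some smaller
cone must contain y as well. -/
theorem InCone.exists_linearIndepOn {v : ι → E} {T : Finset ι} {y : E} (h : InCone v T y) :
    ∃ U ⊆ T, InCone v U y ∧ LinearIndepOn ℝ v (U : Set ι) := by
  classical
  induction T using Finset.strongInduction with
  | H T ih =>
  by_cases hT : LinearIndepOn ℝ v (T : Set ι)
  · exact ⟨T, subset_rfl, h, hT⟩
  rw [linearIndepOn_finset_iff] at hT
  push Not at hT
  obtain ⟨f, hf, t₀, ht₀, h0⟩ := hT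
  obtain ⟨B, u, hu, hB⟩ := exists_isDep hf ht₀ h0
  have key := hu.altSum_coneInd hB y
  obtain ⟨S, hS, hS0, hy⟩ : ∃ S ⊆ B, S ≠ ∅ ∧ InCone v (T \ S) y := by
    by_contra! hne
    rw [altSum, Finset.sum_eq_single ∅] at key
    · simp [coneInd, h] at key
    · intro S hS hS0
      simp [coneInd, hne S (Finset.mem_powerset.1 hS) (Finset.nonempty_iff_ne_empty.2 hS0)]
    · simp
  obtain ⟨U, hU, h1, h2⟩ := ih (T \ S) (Finset.sdiff_ssubset (hS.trans hu.sub)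
    (Finset.nonempty_iff_ne_empty.2 hS0)) hy
  exact ⟨U, hU.trans Finset.sdiff_subset, h1, h2⟩

/-- A finitely generated cone containing a sequence `y + k x` with `k → ∞` contains `x`. -/
theorem InCone.of_frequently {v : ι → E} {T : Finset ι} {x y : E}
    (h : ∃ᶠ k : ℝ in Filter.atTop, InCone v T (y + k • x)) : InCone v T x := by
  classical
  have h' : ∃ᶠ k : ℝ in Filter.atTop, ∃ U ∈ T.powerset,
      InCone v U (y + k • x) ∧ LinearIndepOn ℝ v (U : Set ι) :=
    h.mono fun k hk => by simpa using hk.exists_linearIndepOn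
  -- By pigeonhole one independent subfamily U serves arbitrarily large k. Coefficients with respect
  -- to U are unique, hence affine in k, with slopes the coefficients a of x.
  obtain ⟨U, hUT, hU⟩ := (Filter.frequently_exists_finset _).1 h'
  rw [Finset.mem_powerset] at hUT
  have hli : LinearIndepOn ℝ v (U : Set ι) := hU.exists.choose_spec.2
  have hU' : ∀ K : ℝ, ∃ k > K, InCone v U (y + k • x) := fun K => by
    obtain ⟨k, hk, hk'⟩ := (Filter.frequently_atTop.1 hU) (K + 1)
    exact ⟨k, by linarith, hk'.1⟩
  obtain ⟨k₁, -, c₁, hc₁, e₁⟩ := hU' 0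
  obtain ⟨k₂, hk, c₂, hc₂, e₂⟩ := hU' k₁
  have hk' : k₂ - k₁ ≠ 0 := by linarith
  set a : ι → ℝ := fun t => (k₂ - k₁)⁻¹ * (c₂ t - c₁ t) with ha
  have hx : ∑ t ∈ U, a t • v t = x := by
    simp only [ha, mul_smul, ← Finset.smul_sum, sub_smul, Finset.sum_sub_distrib, e₁, e₂]
    rw [show y + k₂ • x - (y + k₁ • x) = (k₂ - k₁) • x by module, smul_smul,
      inv_mul_cancel₀ hk', one_smul]
  refine InCone.mono ⟨a, fun t ht => ?_, hx⟩ hUT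
  by_contra! hneg
  -- Beyond this value of k the affine coefficient c₁ t + (k - k₁) * a t is negative.
  obtain ⟨k, hkk, c, hc, e⟩ := hU' (k₁ + c₁ t / (-a t))
  have : ∑ s ∈ U, (c s - (c₁ s + (k - k₁) * a s)) • v s = 0 := by
    simp only [sub_smul, add_smul, mul_smul, Finset.sum_sub_distrib, Finset.sum_add_distrib,
      ← Finset.smul_sum, e, e₁, hx]
    module
  have h0 := linearIndepOn_finset_iff.1 hli _ this t ht
  have h1 := hc t ht
  have h2 : c₁ t / (-a t) < k - k₁ := by linarith
  rw [div_lt_iff₀ (by linarith)] at h2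
  nlinarith

/-- The cone generated by the `v t`, `t ∈ V`, contains no line. -/
def Pointed (v : ι → E) (V : Finset ι) : Prop :=
  ∀ a, InCone v V a → InCone v V (-a) → a = 0

theorem Pointed.mono {v : ι → E} {V W : Finset ι} (h : Pointed v V) (hW : W ⊆ V) :
    Pointed v W := fun a h1 h2 => h a (h1.mono hW) (h2.mono hW)

/-- Any member w of a generating subset W of least size works. Suppose v w = Σ l t • v t over V \
{w}, write each v t as μ t • v w plus an element of the cone of W \ {w}, and let m = Σ l t * μ t. If
m < 1, then v w lies in the cone of W \ {w}, against minimality. If m ≥ 1, pointedness kills the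
remainders with l t ≠ 0, which makes some v t parallel to v w. -/
theorem Pointed.exists_extreme [DecidableEq ι] {v : ι → E} {V : Finset ι} (hV : Pointed v V)
    (hne : V.Nonempty)
    (h0 : ∀ t ∈ V, v t ≠ 0) (hpar : ∀ s ∈ V, ∀ t ∈ V, s ≠ t → ∀ c : ℝ, 0 ≤ c → v s ≠ c • v t) :
    ∃ x ∈ V, ¬ InCone v (V.erase x) (v x) := by
  classical
  obtain ⟨W, hW, hmin⟩ := Finset.exists_min_image
    (V.powerset.filter fun W => ∀ t ∈ V, InCone v W (v t)) Finset.card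
    ⟨V, by simpa using fun t ht => InCone.of_mem ht⟩
  simp only [Finset.mem_filter, Finset.mem_powerset] at hW hmin
  obtain ⟨hWV, hWc⟩ := hW
  have hWne : W.Nonempty := by
    rw [Finset.nonempty_iff_ne_empty]
    rintro rfl
    obtain ⟨t, ht⟩ := hne
    obtain ⟨c, -, hc⟩ := hWc t ht
    exact h0 t ht (by simpa using hc.symm)
  obtain ⟨w, hw⟩ := hWne
  refine ⟨w, hWV hw, fun hin => ?_⟩
  have hnot : ¬ InCone v (W.erase w) (v w) := fun hh => by
    have := hmin (W.erase w) ⟨(Finset.erase_subset _ _).trans hWV, fun t ht =>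
      (hWc t ht).trans fun s hs => by
        by_cases hsw : s = w
        · rw [hsw]; exact hh
        · exact InCone.of_mem (Finset.mem_erase.2 ⟨hsw, hs⟩)⟩
    have := Finset.card_erase_lt_of_mem hw
    omega
  have hμ : ∀ t ∈ V, ∃ r : ℝ, 0 ≤ r ∧ InCone v (W.erase w) (v t - r • v w) := fun t ht => by
    have := hWc t ht
    rwa [← Finset.insert_erase hw, inCone_insert (Finset.notMem_erase _ _)] at this
  choose! μ hμ0 hμ using hμ
  obtain ⟨l, hl, hlw⟩ := hin
  have hWV' : W.erase w ⊆ V := (Finset.erase_subset _ _).trans hWV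
  have hVe : ∀ t ∈ V.erase w, t ∈ V := fun t ht => Finset.mem_of_mem_erase ht
  have hq : ∀ t ∈ V.erase w, InCone v (W.erase w) (l t • (v t - μ t • v w)) :=
    fun t ht => (hμ t (hVe t ht)).smul (hl t ht)
  set m := ∑ t ∈ V.erase w, l t * μ t with hm
  have hsum : ∑ t ∈ V.erase w, l t • (v t - μ t • v w) = (1 - m) • v w := by
    simp only [smul_sub, Finset.sum_sub_distrib, hlw, smul_smul, ← Finset.sum_smul, ← hm]
    module
  rcases lt_or_ge m 1 with hm1 | hm1
  · have := (InCone.sum hq).smul (inv_nonneg.2 (sub_nonneg.2 hm1.le))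
    rw [hsum, smul_smul, inv_mul_cancel₀ (by linarith), one_smul] at this
    exact hnot this
  · obtain ⟨t, ht, hlt⟩ : ∃ t ∈ V.erase w, l t ≠ 0 := by
      by_contra! hz
      exact h0 w (hWV hw) (by rw [← hlw, Finset.sum_eq_zero fun t ht => by rw [hz t ht, zero_smul]])
    have hz : l t • (v t - μ t • v w) = 0 := by
      refine hV _ ((hq t ht).mono hWV') ?_
      have e : -(l t • (v t - μ t • v w)) = (m - 1) • v w +
          ∑ s ∈ (V.erase w).erase t, l s • (v s - μ s • v w) := by
        rw [← Finset.add_sum_erase _ _ ht] at hsum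
        rw [← sub_eq_zero, ← neg_eq_zero]
        rw [← sub_eq_zero] at hsum
        rw [← hsum]; module
      rw [e]
      exact ((InCone.of_mem (hWV hw)).smul (sub_nonneg.2 hm1)).add
        (InCone.sum fun s hs => (hq s (Finset.mem_of_mem_erase hs)).mono hWV')
    rw [smul_eq_zero, sub_eq_zero] at hz
    exact hpar t (hVe t ht) w (hWV hw) (Finset.ne_of_mem_erase ht) (μ t) (hμ0 t (hVe t ht))
      (hz.resolve_left hlt)

/-- Membership in the image of a cone modulo a line. -/
theorem inCone_mkQ {v : ι → E} {T : Finset ι} {x y : E} :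
    InCone (fun t => (ℝ ∙ x).mkQ (v t)) T ((ℝ ∙ x).mkQ y) ↔ ∃ k : ℝ, InCone v T (y + k • x) := by
  constructor
  · rintro ⟨c, hc, e⟩
    simp only [← map_smul, ← map_sum] at e
    rw [← sub_eq_zero, ← map_sub, Submodule.mkQ_apply, Submodule.Quotient.mk_eq_zero,
      Submodule.mem_span_singleton] at e
    obtain ⟨k, hk⟩ := e
    exact ⟨k, c, hc, by rw [hk]; abel⟩
  · rintro ⟨k, c, hc, e⟩
    refine ⟨c, hc, ?_⟩
    simp only [← map_smul, ← map_sum]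
    rw [e, map_add, map_smul, Submodule.mkQ_apply, Submodule.mkQ_apply,
      (Submodule.Quotient.mk_eq_zero _).2 (Submodule.mem_span_singleton_self x), smul_zero, add_zero]

/-- Lifts b + k • v x and -b + l • v x of opposite vectors add up to (k + l) • v x. Extremality of x
forces k + l ≤ 0, and then pointedness upstairs gives b + k • v x = 0. -/
theorem Pointed.mkQ [DecidableEq ι] {v : ι → E} {V : Finset ι} (hV : Pointed v V) {x : ι}
    (hx : x ∈ V) (hxV : ¬ InCone v (V.erase x) (v x)) :
    Pointed (fun t => (ℝ ∙ v x).mkQ (v t)) (V.erase x) := by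
  intro a h1 h2
  obtain ⟨b, rfl⟩ := Submodule.mkQ_surjective _ a
  rw [← map_neg] at h2
  obtain ⟨k, hk⟩ := inCone_mkQ.1 h1
  obtain ⟨l, hl⟩ := inCone_mkQ.1 h2
  have hs := hk.add hl
  rw [show b + k • v x + (-b + l • v x) = (k + l) • v x by module] at hs
  have hVe := Finset.erase_subset x V
  rcases lt_or_ge 0 (k + l) with hp | hp
  · have := hs.smul (inv_nonneg.2 hp.le)
    rw [smul_smul, inv_mul_cancel₀ hp.ne', one_smul] at this
    exact absurd this hxV
  · have h3 : b + k • v x = 0 := by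
      refine hV _ (hk.mono hVe) ?_
      have := (hl.mono hVe).add ((InCone.of_mem (v := v) hx).smul (neg_nonneg.2 hp))
      rwa [show -b + l • v x + (-(k + l)) • v x = -(b + k • v x) by module] at this
    rw [eq_neg_of_add_eq_zero_left h3, ← neg_smul, map_smul, Submodule.mkQ_apply,
      (Submodule.Quotient.mk_eq_zero _).2 (Submodule.mem_span_singleton_self (v x)), smul_zero]

/-- Far out in direction v x, a cone having x as a generator looks like the preimage of its image
modulo the line. A cone without x is eventually left, since otherwise it would contain v x by
`InCone.of_frequently`. -/
theorem eventually_coneInd [DecidableEq ι] {v : ι → E} {V : Finset ι} {x : ι}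
    (hxV : ¬ InCone v (V.erase x) (v x)) (y : E) {T : Finset ι} (hT : T ⊆ V) :
    ∀ᶠ k : ℝ in Filter.atTop, coneInd v (y + k • v x) T =
      if x ∈ T then coneInd (fun t => (ℝ ∙ v x).mkQ (v t)) ((ℝ ∙ v x).mkQ y) (T.erase x) else 0 := by
  by_cases hxT : x ∈ T
  · simp only [hxT, if_true]
    have key : ∀ k : ℝ, InCone v T (y + k • v x) ↔
        ∃ r : ℝ, 0 ≤ r ∧ InCone v (T.erase x) (y + (k - r) • v x) := fun k => by
      conv_lhs => rw [← Finset.insert_erase hxT]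
      rw [inCone_insert (Finset.notMem_erase _ _)]
      refine exists_congr fun r => and_congr Iff.rfl ?_
      rw [sub_smul, add_sub_assoc]
    by_cases hq : InCone (fun t => (ℝ ∙ v x).mkQ (v t)) (T.erase x) ((ℝ ∙ v x).mkQ y)
    · obtain ⟨k₀, hk₀⟩ := inCone_mkQ.1 hq
      filter_upwards [Filter.eventually_ge_atTop k₀] with k hk
      have : InCone v T (y + k • v x) :=
        (key k).2 ⟨k - k₀, sub_nonneg.2 hk, by rwa [sub_sub_cancel]⟩
      exact coneInd_eq_of_iff ⟨fun _ => hq, fun _ => this⟩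
    · refine Filter.Eventually.of_forall fun k => coneInd_eq_of_iff ⟨fun h => ?_, fun h => absurd h hq⟩
      obtain ⟨r, -, hr⟩ := (key k).1 h
      exact inCone_mkQ.2 ⟨_, hr⟩
  · simp only [hxT, if_false]
    by_contra hf
    have hfr : ∃ᶠ k : ℝ in Filter.atTop, InCone v T (y + k • v x) := by
      refine (Filter.not_eventually.1 hf).mono fun k hk => ?_
      by_contra hn
      exact hk (by simp [coneInd, hn])
    refine hxV ((InCone.of_frequently hfr).mono fun t ht => Finset.mem_erase.2 ⟨?_, hT ht⟩)
    rintro rfl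
    exact hxT ht

end Localize

/-! ### Radon relations generate all relations between cones -/

section Generation

variable {ι : Type*}

/-- The basis vector of the free group on the finite subsets of `ι`. -/
noncomputable def delta (T : Finset ι) : Finset ι →₀ ℤ := Finsupp.single T 1

/-- Formal combinations of subsets of `V`. -/
noncomputable def subsetSpan (V : Finset ι) : Submodule ℤ (Finset ι →₀ ℤ) :=
  Submodule.span ℤ (delta '' {T | T ⊆ V})

theorem delta_mem {T V : Finset ι} (h : T ⊆ V) : delta T ∈ subsetSpan V :=
  Submodule.subset_span ⟨T, h, rfl⟩

theorem linearCombination_delta {M : Type*} [AddCommGroup M] (Ψ : Finset ι → M) (T : Finset ι) :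
    Finsupp.linearCombination ℤ Ψ (delta T) = Ψ T := by
  simp [delta]

theorem subsetSpan_ext {M : Type*} [AddCommGroup M] {V : Finset ι}
    {f g : (Finset ι →₀ ℤ) →ₗ[ℤ] M} (h : ∀ T ⊆ V, f (delta T) = g (delta T))
    {n : Finset ι →₀ ℤ} (hn : n ∈ subsetSpan V) : f n = g n := by
  refine LinearMap.eqOn_span (s := delta '' {T | T ⊆ V}) ?_ hn
  rintro _ ⟨T, hT, rfl⟩
  exact h T hT

theorem map_mem_of_subsetSpan {M : Type*} [AddCommGroup M] {V : Finset ι} {P : Submodule ℤ M}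
    (f : (Finset ι →₀ ℤ) →ₗ[ℤ] M) (h : ∀ T ⊆ V, f (delta T) ∈ P)
    {n : Finset ι →₀ ℤ} (hn : n ∈ subsetSpan V) : f n ∈ P := by
  have : subsetSpan V ≤ P.comap f := by
    refine Submodule.span_le.2 ?_
    rintro _ ⟨T, hT, rfl⟩
    exact h T hT
  exact this hn

variable {E : Type*} [AddCommGroup E] [Module ℝ E]

/-- The function on `E` represented by a formal combination of cones, at the point `y`. -/
noncomputable def coneEval (v : ι → E) (y : E) : (Finset ι →₀ ℤ) →ₗ[ℤ] ℤ :=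
  Finsupp.linearCombination ℤ (coneInd v y)

theorem coneEval_delta (v : ι → E) (y : E) (T : Finset ι) :
    coneEval v y (delta T) = coneInd v y T :=
  linearCombination_delta _ _

variable [DecidableEq ι]

theorem linearCombination_altSum_delta {M : Type*} [AddCommGroup M] (Ψ : Finset ι → M)
    (T B : Finset ι) :
    Finsupp.linearCombination ℤ Ψ (altSum delta T B) = altSum Ψ T B := by
  have := map_altSum (Finsupp.linearCombination ℤ Ψ).toAddMonoidHom delta T B
  simpa [linearCombination_delta] using this

/-- The formal Radon relations among the cones spanned by subfamilies of `V`. -/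
noncomputable def radonSpan (v : ι → E) (V : Finset ι) : Submodule ℤ (Finset ι →₀ ℤ) :=
  Submodule.span ℤ {x | ∃ T B u, T ⊆ V ∧ IsDep v T B u ∧ B.Nonempty ∧ x = altSum delta T B}

theorem IsDep.mem_radonSpan {v : ι → E} {V T B : Finset ι} {u : ι → ℝ} (h : IsDep v T B u)
    (hT : T ⊆ V) (hB : B.Nonempty) : altSum delta T B ∈ radonSpan v V :=
  Submodule.subset_span ⟨T, B, u, hT, h, hB, rfl⟩

theorem radonSpan_mono (v : ι → E) {V W : Finset ι} (h : V ⊆ W) :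
    radonSpan v V ≤ radonSpan v W :=
  Submodule.span_mono fun _ ⟨T, B, u, hT, h'⟩ => ⟨T, B, u, hT.trans h, h'⟩

theorem coneEval_radonSpan {v : ι → E} {V : Finset ι} {n : Finset ι →₀ ℤ}
    (hn : n ∈ radonSpan v V) (y : E) : coneEval v y n = 0 := by
  have : radonSpan v V ≤ LinearMap.ker (coneEval v y) := by
    refine Submodule.span_le.2 ?_
    rintro _ ⟨T, B, u, -, h, hB, rfl⟩
    exact (linearCombination_altSum_delta _ _ _).trans (h.altSum_coneInd hB y)
  exact this hn

/-- Elimination of a generator that vanishes or is parallel to another one. -/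
theorem exists_elim_of_parallel {v : ι → E} {V : Finset ι} {x : ι} (hx : x ∈ V)
    (h : v x = 0 ∨ ∃ t ∈ V, x ≠ t ∧ ∃ c : ℝ, 0 < c ∧ v x = c • v t)
    {n : Finset ι →₀ ℤ} (hn : n ∈ subsetSpan V) :
    ∃ m ∈ subsetSpan (V.erase x), n - m ∈ radonSpan v V := by
  obtain ⟨ρ, hρ, hρ'⟩ : ∃ ρ : Finset ι → Finset ι, (∀ T ⊆ V, ρ T ⊆ V.erase x) ∧
      ∀ T ⊆ V, delta T - delta (ρ T) ∈ radonSpan v V := by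
    rcases h with h0 | ⟨t, ht, hxt, c, hc, hct⟩
    · refine ⟨fun T => T.erase x, fun T hT => Finset.erase_subset_erase x hT, fun T hT => ?_⟩
      by_cases hxT : x ∈ T
      · rw [← altSum_singleton]
        refine IsDep.mem_radonSpan (u := Pi.single x 1) ⟨by simpa using hxT, by simp, fun s _ hs => ?_, ?_⟩
          hT (Finset.singleton_nonempty x)
        · rw [Pi.single_eq_of_ne (by simpa using hs)]
        · rw [Finset.sum_eq_single x (fun s _ hs => by rw [Pi.single_eq_of_ne hs, zero_smul])
            (fun h => absurd hxT h), h0, smul_zero]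
      · simp [Finset.erase_eq_of_notMem hxT]
    · have d1 : ∀ T ⊆ V, x ∈ T → t ∈ T → delta T - delta (T.erase x) ∈ radonSpan v V := by
        intro T hT hxT htT
        rw [← altSum_singleton]
        refine IsDep.mem_radonSpan (u := Pi.single x 1 - Pi.single t c)
          ⟨by simpa using hxT, ?_, fun s _ hs => ?_, ?_⟩ hT (Finset.singleton_nonempty x)
        · simp [hxt]
        · rw [Pi.sub_apply, Pi.single_eq_of_ne (by simpa using hs)]
          by_cases hst : s = t
          · subst hst; simp [hc.le]
          · simp [hst]
        · simp only [Pi.sub_apply, sub_smul, Finset.sum_sub_distrib, Pi.single_apply, ite_smul,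
            zero_smul, Finset.sum_ite_eq', hxT, htT, if_true, one_smul, hct, sub_self]
      have d2 : ∀ T ⊆ V, x ∈ T → t ∈ T → delta T - delta (T.erase t) ∈ radonSpan v V := by
        intro T hT hxT htT
        rw [← altSum_singleton]
        refine IsDep.mem_radonSpan (u := Pi.single t c - Pi.single x 1)
          ⟨by simpa using htT, ?_, fun s _ hs => ?_, ?_⟩ hT (Finset.singleton_nonempty t)
        · simp [hxt.symm, hc]
        · rw [Pi.sub_apply, Pi.single_eq_of_ne (by simpa using hs)]
          by_cases hst : s = x
          · subst hst; simp
          · simp [hst]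
        · simp only [Pi.sub_apply, sub_smul, Finset.sum_sub_distrib, Pi.single_apply, ite_smul,
            zero_smul, Finset.sum_ite_eq', hxT, htT, if_true, one_smul, hct, sub_self]
      refine ⟨fun T => if x ∈ T then insert t (T.erase x) else T, fun T hT => ?_, fun T hT => ?_⟩
      · dsimp only
        split_ifs with hxT
        · refine Finset.insert_subset (Finset.mem_erase.2 ⟨hxt.symm, ht⟩) (Finset.erase_subset_erase x hT)
        · exact fun s hs => Finset.mem_erase.2 ⟨fun e => hxT (e ▸ hs), hT hs⟩
      · dsimp only
        split_ifs with hxT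
        · by_cases htT : t ∈ T
          · rw [Finset.insert_eq_of_mem (Finset.mem_erase.2 ⟨hxt.symm, htT⟩)]
            exact d1 T hT hxT htT
          -- Compare through T ∪ {t}, from which either of the parallel generators x and t may be
          -- deleted.
          · have hU := Finset.insert_subset ht hT
            have a1 := d1 (insert t T) hU (by simp [hxT]) (by simp)
            have a2 := d2 (insert t T) hU (by simp [hxT]) (by simp)
            rw [Finset.erase_insert htT] at a2
            rw [Finset.erase_insert_of_ne hxt.symm] at a1
            convert sub_mem a1 a2 using 1
            abel
        · simp
  let f : (Finset ι →₀ ℤ) →ₗ[ℤ] (Finset ι →₀ ℤ) := Finsupp.linearCombination ℤ fun T => delta (ρ T)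
  refine ⟨f n, map_mem_of_subsetSpan f (fun T hT => ?_) hn, ?_⟩
  · rw [linearCombination_delta]; exact delta_mem (hρ T hT)
  · refine map_mem_of_subsetSpan (LinearMap.id - f) (fun T hT => ?_) hn
    rw [LinearMap.sub_apply, linearCombination_delta]
    exact hρ' T hT

/-- Lifting Radon relations from the quotient by a generator. -/
theorem lift_radonSpan {v : ι → E} {V : Finset ι} {x : ι} (hx : x ∈ V) {n : Finset ι →₀ ℤ}
    (hn : n ∈ radonSpan (fun t => (ℝ ∙ v x).mkQ (v t)) (V.erase x)) :
    Finsupp.linearCombination ℤ (fun T => delta (insert x T)) n ∈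
      radonSpan v V ⊔ subsetSpan (V.erase x) := by
  have : radonSpan (fun t => (ℝ ∙ v x).mkQ (v t)) (V.erase x) ≤
      (radonSpan v V ⊔ subsetSpan (V.erase x)).comap
        (Finsupp.linearCombination ℤ (fun T => delta (insert x T))) := by
    refine Submodule.span_le.2 ?_
    rintro _ ⟨T, B, u, hT, h, hB, rfl⟩
    change Finsupp.linearCombination ℤ (fun T => delta (insert x T)) (altSum delta T B) ∈
      radonSpan v V ⊔ subsetSpan (V.erase x)
    rw [linearCombination_altSum_delta]
    have hxT : x ∉ T := fun h => by simpa using hT h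
    have hxB : x ∉ B := fun h' => hxT (h.sub h')
    have hTV : insert x T ⊆ V := Finset.insert_subset hx (hT.trans (Finset.erase_subset _ _))
    have e1 : altSum (fun T => delta (insert x T)) T B = altSum delta (insert x T) B :=
      altSum_congr fun S hS => by
        rw [Finset.insert_sdiff_of_notMem _ fun hxS => hxB (hS hxS)]
    rw [e1]
    have hdep := h.dep
    simp only [← map_smul, ← map_sum] at hdep
    rw [Submodule.mkQ_apply, Submodule.Quotient.mk_eq_zero, Submodule.mem_span_singleton] at hdep
    obtain ⟨a, ha⟩ := hdep
    have hu : ∀ t ∈ T, Function.update u x (-a) t = u t := fun t ht =>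
      Function.update_of_ne (by rintro rfl; exact hxT ht) _ _
    have hsum : ∑ t ∈ insert x T, Function.update u x (-a) t • v t = 0 := by
      rw [Finset.sum_insert hxT, Finset.sum_congr rfl fun t ht => by rw [hu t ht], ← ha]
      simp
    -- The lifted dependence has coefficient -a at x. If it is nonpositive, B is unchanged and the
    -- lifted sum is itself a Radon relation. If it is positive, x joins B, and the Radon relation
    -- differs from the lifted sum by terms without x.
    rcases le_or_gt 0 a with ha0 | ha0
    · refine Submodule.mem_sup_left (IsDep.mem_radonSpan (u := Function.update u x (-a))
        ⟨h.sub.trans (Finset.subset_insert _ _), fun t ht => ?_, fun t ht htB => ?_, hsum⟩ hTV hB)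
      · rw [hu t (h.sub ht)]; exact h.pos t ht
      · rcases Finset.mem_insert.1 ht with rfl | ht
        · simpa using ha0
        · rw [hu t ht]; exact h.nonpos t ht htB
    · have d : IsDep v (insert x T) (insert x B) (Function.update u x (-a)) := by
        refine ⟨Finset.insert_subset_insert _ h.sub, fun t ht => ?_, fun t ht htB => ?_, hsum⟩
        · rcases Finset.mem_insert.1 ht with rfl | ht
          · simpa using ha0
          · rw [hu t (h.sub ht)]; exact h.pos t ht
        · simp only [Finset.mem_insert, not_or] at ht htB
          have ht := ht.resolve_left htB.1
          rw [hu t ht]; exact h.nonpos t ht htB.2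
      have h1 := d.mem_radonSpan hTV (Finset.insert_nonempty _ _)
      rw [altSum_insert _ _ hxB, Finset.erase_insert hxT] at h1
      have h2 : altSum delta T B ∈ subsetSpan (V.erase x) :=
        sum_mem fun S _ => Submodule.smul_mem _ _ (delta_mem (Finset.sdiff_subset.trans hT))
      simpa using add_mem (Submodule.mem_sup_left (T := subsetSpan (V.erase x)) h1)
        (Submodule.mem_sup_right (S := radonSpan v V) h2)
  exact this hn

end Generation

/-- All linear relations among the indicator functions of the cones spanned by subfamilies of a
family spanning a pointed cone are generated by the Radon relations. -/
theorem mem_radonSpan_of_coneEval {ι : Type*} [DecidableEq ι] (N : ℕ) :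
    ∀ {E : Type*} [AddCommGroup E] [Module ℝ E] (v : ι → E) (V : Finset ι) (n : Finset ι →₀ ℤ),
    V.card = N → Pointed v V → n ∈ subsetSpan V → (∀ y, coneEval v y n = 0) →
    n ∈ radonSpan v V := by
  induction N with
  | zero =>
    intro E _ _ v V n hV _ hn hev
    rw [Finset.card_eq_zero] at hV
    subst hV
    have : subsetSpan (∅ : Finset ι) = Submodule.span ℤ {delta ∅} := by
      unfold subsetSpan
      congr 1
      ext z
      simp [Finset.subset_empty]
    rw [this, Submodule.mem_span_singleton] at hn
    obtain ⟨z, rfl⟩ := hn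
    have h0 := hev 0
    have h1 : coneInd v 0 ∅ = 1 := by simp [coneInd, InCone.zero]
    rw [map_smul, coneEval_delta, h1] at h0
    have : z = 0 := by simpa using h0
    simp [this]
  | succ N ih =>
    intro E _ _ v V n hV hp hn hev
    have hcard : ∀ x ∈ V, (V.erase x).card = N := fun x hx => by
      rw [Finset.card_erase_of_mem hx, hV]; rfl
    by_cases hpar : ∃ x ∈ V, v x = 0 ∨ ∃ t ∈ V, x ≠ t ∧ ∃ c : ℝ, 0 < c ∧ v x = c • v t
    · obtain ⟨x, hx, hpar⟩ := hpar
      obtain ⟨m, hm, hnm⟩ := exists_elim_of_parallel hx hpar hn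
      have hm' : m ∈ radonSpan v (V.erase x) := by
        refine ih v _ m (hcard x hx) (hp.mono (Finset.erase_subset _ _)) hm fun y => ?_
        have := coneEval_radonSpan hnm y
        rw [map_sub, hev y] at this
        simpa using this
      simpa using add_mem hnm (radonSpan_mono v (Finset.erase_subset x V) hm')
    · push Not at hpar
      obtain ⟨x, hx, hxV⟩ := hp.exists_extreme (Finset.card_pos.1 (by omega))
        (fun t ht => (hpar t ht).1) fun s hs t ht hst c hc => by
          rcases hc.eq_or_lt with rfl | hc
          · simpa using (hpar s hs).1
          · exact (hpar s hs).2 t ht hst c hc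
      let w : ι → E ⧸ (ℝ ∙ v x) := fun t => (ℝ ∙ v x).mkQ (v t)
      let q : (Finset ι →₀ ℤ) →ₗ[ℤ] (Finset ι →₀ ℤ) :=
        Finsupp.linearCombination ℤ fun T => if x ∈ T then delta (T.erase x) else 0
      let r : (Finset ι →₀ ℤ) →ₗ[ℤ] (Finset ι →₀ ℤ) :=
        Finsupp.linearCombination ℤ fun T => if x ∈ T then 0 else delta T
      let Λ : (Finset ι →₀ ℤ) →ₗ[ℤ] (Finset ι →₀ ℤ) :=
        Finsupp.linearCombination ℤ fun T => delta (insert x T)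
      have hq : q n ∈ subsetSpan (V.erase x) := by
        refine map_mem_of_subsetSpan q (fun T hT => ?_) hn
        rw [linearCombination_delta]
        split_ifs
        · exact delta_mem (Finset.erase_subset_erase x hT)
        · exact zero_mem _
      have hr : r n ∈ subsetSpan (V.erase x) := by
        refine map_mem_of_subsetSpan r (fun T hT => ?_) hn
        rw [linearCombination_delta]
        split_ifs with hxT
        · exact zero_mem _
        · exact delta_mem fun s hs => Finset.mem_erase.2 ⟨fun e => hxT (e ▸ hs), hT hs⟩
      have hsplit : n = Λ (q n) + r n := by
        refine subsetSpan_ext (V := V) (f := LinearMap.id) (g := Λ ∘ₗ q + r) (fun T _ => ?_) hn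
        simp only [LinearMap.id_apply, LinearMap.add_apply, LinearMap.comp_apply, q, r,
          linearCombination_delta]
        split_ifs with hxT
        · simp only [Λ, linearCombination_delta, Finset.insert_erase hxT, add_zero]
        · simp
      -- Evaluating the relation n far out along v x leaves exactly the terms containing x, read in
      -- the quotient. This is a relation between cones there, with one generator fewer.
      have hqw : q n ∈ radonSpan w (V.erase x) := by
        refine ih w _ (q n) (hcard x hx) (hp.mkQ hx hxV) hq fun z => ?_
        obtain ⟨y, rfl⟩ := Submodule.mkQ_surjective _ z
        have hall : ∀ᶠ k : ℝ in Filter.atTop, ∀ T ∈ V.powerset, coneInd v (y + k • v x) T =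
            if x ∈ T then coneInd w ((ℝ ∙ v x).mkQ y) (T.erase x) else 0 :=
          (Filter.eventually_all_finset _).2 fun T hT =>
            eventually_coneInd hxV y (Finset.mem_powerset.1 hT)
        obtain ⟨k, hk⟩ := hall.exists
        rw [← hev (y + k • v x)]
        refine subsetSpan_ext (V := V) (f := coneEval w ((ℝ ∙ v x).mkQ y) ∘ₗ q)
          (g := coneEval v (y + k • v x)) (fun T hT => ?_) hn
        rw [coneEval_delta, hk T (Finset.mem_powerset.2 hT), LinearMap.comp_apply]
        simp only [q, linearCombination_delta]
        split_ifs
        · rw [coneEval_delta]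
        · simp
      -- Modulo Radon relations, the terms containing x are traded for terms without it; what
      -- remains is a relation over V \ {x}, to which induction applies.
      obtain ⟨h, hh, m, hm, hhm⟩ := Submodule.mem_sup.1 (lift_radonSpan hx hqw)
      have hn' : n = h + (m + r n) := by
        rw [← add_assoc, hhm]; exact hsplit
      have hmr : m + r n ∈ radonSpan v (V.erase x) := by
        refine ih v _ _ (hcard x hx) (hp.mono (Finset.erase_subset _ _)) (add_mem hm hr) fun y => ?_
        have := hev y
        rwa [hn', map_add, coneEval_radonSpan hh y, zero_add] at this
      rw [hn']
      exact add_mem hh (radonSpan_mono v (Finset.erase_subset x V) hmr)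

/-! ### From two positive coefficients to arbitrary Radon relations -/

section Extension

variable {ι E G : Type*} [DecidableEq ι] [AddCommGroup E] [Module ℝ E] [AddCommGroup G]

/-- Modify the coefficients `u` by `r` times the dependence `v c = s • v p + (1 - s) • v b`. -/
def extendCoeff (u : ι → ℝ) (p b c : ι) (s r : ℝ) : ι → ℝ := fun t =>
  Function.update u p 0 t + r * ((if t = c then 1 else 0) - (if t = p then s else 0) -
    (if t = b then 1 - s else 0))

variable {v : ι → E} {T : Finset ι} {u : ι → ℝ} {p b c : ι} {s : ℝ}

theorem sum_extendCoeff (hu : ∑ t ∈ T, u t • v t = 0) (hp : p ∉ T) (hb : b ∈ T) (hc : c ∈ T)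
    (hv : v c = s • v p + (1 - s) • v b) (r : ℝ) :
    ∑ t ∈ insert p T, extendCoeff u p b c s r t • v t = 0 := by
  have h1 : ∑ t ∈ insert p T, Function.update u p 0 t • v t = 0 := by
    rw [Finset.sum_insert hp, Function.update_self, zero_smul, zero_add, ← hu]
    refine Finset.sum_congr rfl fun t ht => ?_
    rw [Function.update_of_ne (by rintro rfl; exact hp ht)]
  have hb' : b ∈ insert p T := Finset.mem_insert_of_mem hb
  have hc' : c ∈ insert p T := Finset.mem_insert_of_mem hc
  simp only [extendCoeff, add_smul, mul_smul, sub_smul, Finset.sum_add_distrib, h1,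
    ← Finset.smul_sum, Finset.sum_sub_distrib, ite_smul, zero_smul, Finset.sum_ite_eq', hb', hc',
    Finset.mem_insert_self, if_true, one_smul]
  rw [hv]; module

theorem sum_extendCoeff_erase (hu : ∑ t ∈ T, u t • v t = 0) (hp : p ∉ T) (hb : b ∈ T) (hc : c ∈ T)
    (hv : v c = s • v p + (1 - s) • v b) {r : ℝ} {a : ι} (ha : extendCoeff u p b c s r a = 0) :
    ∑ t ∈ (insert p T).erase a, extendCoeff u p b c s r t • v t = 0 := by
  rw [Finset.sum_erase _ (by rw [ha, zero_smul])]
  exact sum_extendCoeff hu hp hb hc hv r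

theorem extendCoeff_self (hpc : p ≠ c) (hpb : p ≠ b) (r : ℝ) :
    extendCoeff u p b c s r p = -(r * s) := by
  simp [extendCoeff, hpc, hpb]

theorem extendCoeff_left (hpb : p ≠ b) (hbc : b ≠ c) (r : ℝ) :
    extendCoeff u p b c s r b = u b - r * (1 - s) := by
  simp [extendCoeff, hpb.symm, hbc]; ring

theorem extendCoeff_right (hpc : p ≠ c) (hbc : b ≠ c) (r : ℝ) :
    extendCoeff u p b c s r c = u c + r := by
  simp [extendCoeff, hpc.symm, hbc.symm]

theorem extendCoeff_of_ne {t : ι} (hp : t ≠ p) (hb : t ≠ b) (hc : t ≠ c) (r : ℝ) :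
    extendCoeff u p b c s r t = u t := by
  simp [extendCoeff, hp, hb, hc]

/-- A function on finite subsets of `M` that satisfies the Radon relations with at most two positive
coefficients. -/
structure IsWeaklyAdditive (v : ι → E) (M : Set ι) (Ψ : Finset ι → G) : Prop where
  extend : ∀ (T : Finset ι), ∀ b ∈ M, ∀ c ∈ M, b ≠ c → ∀ ε : ℝ, 0 < ε →
    ∃ p ∈ M, p ∉ T ∧ ∃ s : ℝ, 0 < s ∧ s < ε ∧ s < 1 ∧ v c = s • v p + (1 - s) • v b
  exists_neg : ∀ (T B : Finset ι) (u : ι → ℝ), (T : Set ι) ⊆ M → IsDep v T B u → B.Nonempty →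
    ∃ c ∈ T, u c < 0
  one : ∀ (T : Finset ι) (b : ι) (u : ι → ℝ), (T : Set ι) ⊆ M → IsDep v T {b} u →
    Ψ T = Ψ (T.erase b)
  two : ∀ (T : Finset ι) (a b : ι) (u : ι → ℝ), a ≠ b → (T : Set ι) ⊆ M → IsDep v T {a, b} u →
    altSum Ψ T {a, b} = 0

variable {M : Set ι} {Ψ : Finset ι → G}

/-- Since v c is a positive combination of v p and v b, the dependence expressing this gives two
relations on T ∪ {p}: with c as its only positive index, and, after a change of sign, with p and b
positive. Eliminating Ψ(T ∪ {p}) between them gives the claim. -/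
theorem IsWeaklyAdditive.swap (h : IsWeaklyAdditive v M Ψ) (hT : (T : Set ι) ⊆ M) (hpM : p ∈ M)
    (hp : p ∉ T) (hb : b ∈ T) (hc : c ∈ T) (hbc : b ≠ c) (hs : 0 < s) (hs1 : s < 1)
    (hv : v c = s • v p + (1 - s) • v b) :
    Ψ T - Ψ (T.erase b) = Ψ ((insert p T).erase c) - Ψ ((insert p T).erase b) := by
  have hpb : p ≠ b := by rintro rfl; exact hp hb
  have hpc : p ≠ c := by rintro rfl; exact hp hc
  have hTp : ((insert p T : Finset ι) : Set ι) ⊆ M := by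
    rw [Finset.coe_insert]; exact Set.insert_subset hpM hT
  have h0 : ∑ t ∈ T, (0 : ι → ℝ) t • v t = 0 := by simp
  have d1 := h.one (insert p T) c (extendCoeff 0 p b c s 1) hTp ⟨by simp [hc], by
      simp [extendCoeff_right hpc hbc], fun t _ htc => ?_, sum_extendCoeff h0 hp hb hc hv 1⟩
  · have d2 := h.two (insert p T) p b (extendCoeff 0 p b c s (-1)) hpb hTp
      ⟨by intro t; simp only [Finset.mem_insert, Finset.mem_singleton]; rintro (rfl | rfl) <;> simp [hb],
      fun t ht => ?_, fun t _ htB => ?_, sum_extendCoeff h0 hp hb hc hv (-1)⟩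
    · rw [altSum_pair _ _ hpb, Finset.erase_insert hp, d1] at d2
      rw [sub_eq_zero] at d2
      exact d2.symm
    · simp only [Finset.mem_insert, Finset.mem_singleton] at ht
      rcases ht with rfl | rfl
      · rw [extendCoeff_self hpc hpb]; linarith
      · rw [extendCoeff_left hpb hbc]; simp only [Pi.zero_apply]; linarith
    · simp only [Finset.mem_insert, Finset.mem_singleton, not_or] at htB
      by_cases htc : t = c
      · subst htc; rw [extendCoeff_right hpc hbc]; simp
      · rw [extendCoeff_of_ne htB.1 htB.2 htc]; simp
  · simp only [Finset.mem_singleton] at htc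
    by_cases htp : t = p
    · subst htp; rw [extendCoeff_self hpc hpb]; linarith
    · by_cases htb : t = b
      · subst htb; rw [extendCoeff_left hpb hbc]; simp only [Pi.zero_apply]; linarith
      · rw [extendCoeff_of_ne htp htb htc]; simp

theorem IsWeaklyAdditive.swap_altSum (h : IsWeaklyAdditive v M Ψ) (hT : (T : Set ι) ⊆ M)
    (hpM : p ∈ M) (hp : p ∉ T) (hb : b ∈ T) (hc : c ∈ T) (hbc : b ≠ c) (hs : 0 < s) (hs1 : s < 1)
    (hv : v c = s • v p + (1 - s) • v b) {B : Finset ι} (hBT : B ⊆ T) (hbB : b ∉ B) (hcB : c ∉ B) :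
    altSum Ψ T B - altSum Ψ (T.erase b) B =
      altSum Ψ ((insert p T).erase c) B - altSum Ψ ((insert p T).erase b) B := by
  rw [← altSum_erase, ← altSum_erase, ← altSum_erase, ← altSum_sub, ← altSum_sub]
  refine altSum_congr fun S hS => ?_
  rw [Finset.insert_sdiff_of_notMem _ fun hpS => hp (hBT (hS hpS))]
  refine h.swap (fun t ht => hT ?_) hpM (fun hh => hp (Finset.mem_sdiff.1 hh).1) ?_ ?_ hbc hs hs1 hv
  · exact (Finset.mem_sdiff.1 (Finset.mem_coe.1 ht)).1
  · exact Finset.mem_sdiff.2 ⟨hb, fun hh => hbB (hS hh)⟩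
  · exact Finset.mem_sdiff.2 ⟨hc, fun hh => hcB (hS hh)⟩

/-- Adding multiples of the dependence among c, p and b to u cancels either c (multiple -u c) or b
(multiple u b / (1 - s)). Both results have positive set B \ {b}, so induction kills the right side
of `swap_altSum`. -/
theorem IsWeaklyAdditive.altSum_of_lt (h : IsWeaklyAdditive v M Ψ) {n : ℕ}
    (ih : ∀ (T B : Finset ι) (u : ι → ℝ), (T : Set ι) ⊆ M → IsDep v T B u → B.card = n →
      altSum Ψ T B = 0)
    {B : Finset ι} (hT : (T : Set ι) ⊆ M) (hu : IsDep v T B u) (hB : B.card = n + 1)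
    (hb : b ∈ B) (hc : c ∈ T) (hlt : u b < -u c) :
    altSum Ψ T B = 0 := by
  have hb0 := hu.pos b hb
  have hc0 : u c < 0 := by linarith
  have hbT := hu.sub hb
  have hcB : c ∉ B := fun hh => by linarith [hu.pos c hh]
  have hbc : b ≠ c := by rintro rfl; exact hcB hb
  -- The bound on s amounts to u b < -u c * (1 - s), so b stays nonpositive when c is cancelled, and
  -- c when b is cancelled.
  obtain ⟨p, hpM, hp, s, hs, hs', hs1, hv⟩ := h.extend T b (hT hbT) c (hT hc) hbc
    (1 - u b / (-u c)) (by rw [sub_pos, div_lt_one (by linarith)]; exact hlt)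
  have hpb : p ≠ b := by rintro rfl; exact hp hbT
  have hpc : p ≠ c := by rintro rfl; exact hp hc
  have hle : u b ≤ -u c * (1 - s) := by
    have : u b / (-u c) ≤ 1 - s := by linarith
    rw [div_le_iff₀ (by linarith)] at this
    linarith
  have hpB : p ∉ B := fun hh => hp (hu.sub hh)
  have hTp : ∀ a, (((insert p T).erase a : Finset ι) : Set ι) ⊆ M := fun a t ht => by
    rcases Finset.mem_insert.1 (Finset.mem_of_mem_erase (Finset.mem_coe.1 ht)) with rfl | ht
    exacts [hpM, hT ht]
  have hcard : (B.erase b).card = n := by rw [Finset.card_erase_of_mem hb, hB]; rfl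
  have hne : ∀ t ∈ B.erase b, t ≠ p ∧ t ≠ b ∧ t ≠ c := fun t ht => by
    have := Finset.mem_erase.1 ht
    exact ⟨by rintro rfl; exact hpB this.2, this.1, by rintro rfl; exact hcB this.2⟩
  have hsub : ∀ a, a ∉ B.erase b → B.erase b ⊆ (insert p T).erase a := fun a ha t ht =>
    Finset.mem_erase.2 ⟨by rintro rfl; exact ha ht,
      Finset.mem_insert_of_mem (hu.sub (Finset.mem_of_mem_erase ht))⟩
  have hgen : ∀ (a : ι) (r : ℝ), 0 ≤ r → u b - r * (1 - s) ≤ 0 → u c + r ≤ 0 →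
      a ∉ B.erase b → extendCoeff u p b c s r a = 0 →
      altSum Ψ ((insert p T).erase a) (B.erase b) = 0 := by
    intro a r hr h1 h2 ha ha0
    refine ih _ _ _ (hTp a) ⟨hsub a ha, fun t ht => ?_, fun t ht htB => ?_,
      sum_extendCoeff_erase hu.dep hp hbT hc hv ha0⟩ hcard
    · obtain ⟨e1, e2, e3⟩ := hne t ht
      rw [extendCoeff_of_ne e1 e2 e3]
      exact hu.pos t (Finset.mem_of_mem_erase ht)
    · by_cases htp : t = p
      · subst htp; rw [extendCoeff_self hpc hpb]
        have := mul_nonneg hr hs.le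
        linarith
      by_cases htb : t = b
      · subst htb; rw [extendCoeff_left hpb hbc]; exact h1
      by_cases htc : t = c
      · subst htc; rw [extendCoeff_right hpc hbc]; exact h2
      rw [extendCoeff_of_ne htp htb htc]
      refine hu.nonpos t ?_ fun hh => htB (Finset.mem_erase.2 ⟨htb, hh⟩)
      exact (Finset.mem_insert.1 (Finset.mem_of_mem_erase ht)).resolve_left htp
  have hs2 : 0 < 1 - s := by linarith
  have e1 := hgen c (-u c) (by linarith) (by linarith) (by linarith)
    (fun hh => hcB (Finset.mem_of_mem_erase hh)) (by rw [extendCoeff_right hpc hbc]; ring)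
  have e2 := hgen b (u b / (1 - s)) (by positivity)
    (by rw [div_mul_cancel₀ _ hs2.ne']; linarith)
    (by
      have : u b / (1 - s) ≤ -u c := by rw [div_le_iff₀ hs2]; exact hle
      linarith) (Finset.notMem_erase _ _)
    (by rw [extendCoeff_left hpb hbc, div_mul_cancel₀ _ hs2.ne', sub_self])
  have key := h.swap_altSum hT hpM hp hbT hc hbc hs hs1 hv (B := B.erase b)
    ((Finset.erase_subset _ _).trans hu.sub) (Finset.notMem_erase _ _)
    (fun hh => hcB (Finset.mem_of_mem_erase hh))
  rw [e1, e2, sub_zero, ← altSum_insert _ _ (Finset.notMem_erase _ _), Finset.insert_erase hb] at key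
  exact key

/-- Trade c for p. The new dependence has equally many positive coefficients, but the one at p is u
c * s, small enough against the negative u d for `altSum_of_lt`. Cancelling b instead leaves one
positive coefficient fewer, and `swap_altSum` ties the two to the original sum. -/
theorem IsWeaklyAdditive.altSum_succ (h : IsWeaklyAdditive v M Ψ) {n : ℕ}
    (ih : ∀ (T B : Finset ι) (u : ι → ℝ), (T : Set ι) ⊆ M → IsDep v T B u → B.card = n + 1 →
      altSum Ψ T B = 0)
    {B : Finset ι} (hT : (T : Set ι) ⊆ M) (hu : IsDep v T B u) (hB : B.card = n + 2) :
    altSum Ψ T B = 0 := by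
  obtain ⟨b, B₁, hb₁, rfl, hB₁⟩ := Finset.card_eq_succ.1 hB
  obtain ⟨c, B', hc', rfl, hB'⟩ := Finset.card_eq_succ.1 hB₁
  have hbc : b ≠ c := fun e => hb₁ (by simp [e])
  have hb' : b ∉ B' := fun e => hb₁ (by simp [e])
  have hbT : b ∈ T := hu.sub (by simp)
  have hcT : c ∈ T := hu.sub (by simp)
  have hβ := hu.pos b (by simp)
  have hγ := hu.pos c (by simp)
  obtain ⟨d, hdT, hd⟩ := h.exists_neg T _ u hT hu (Finset.insert_nonempty _ _)
  obtain ⟨p, hpM, hp, s, hs, hs', hs1, hv⟩ := h.extend T b (hT hbT) c (hT hcT) hbc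
    (-u d / u c) (div_pos (by linarith) hγ)
  have hs2 : 0 < 1 - s := by linarith
  have hpb : p ≠ b := by rintro rfl; exact hp hbT
  have hpc : p ≠ c := by rintro rfl; exact hp hcT
  have hpd : p ≠ d := by rintro rfl; exact hp hdT
  have hbd : b ≠ d := by rintro rfl; linarith
  have hcd : c ≠ d := by rintro rfl; linarith
  have hB'T : B' ⊆ T := fun t ht => hu.sub (by simp [ht])
  have hpB' : p ∉ B' := fun hh => hp (hB'T hh)
  have hTp : ∀ a, (((insert p T).erase a : Finset ι) : Set ι) ⊆ M := fun a t ht => by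
    rcases Finset.mem_insert.1 (Finset.mem_of_mem_erase (Finset.mem_coe.1 ht)) with rfl | ht
    exacts [hpM, hT ht]
  have hne : ∀ t ∈ B', t ≠ p ∧ t ≠ b ∧ t ≠ c := fun t ht =>
    ⟨by rintro rfl; exact hpB' ht, by rintro rfl; exact hb' ht, by rintro rfl; exact hc' ht⟩
  have hsm : u c * s < -u d := by
    rw [lt_div_iff₀ hγ] at hs'; linarith
  have α : altSum Ψ ((insert p T).erase c) (insert p (insert b B')) = 0 := by
    refine h.altSum_of_lt (u := extendCoeff u p b c s (-u c)) (b := p) (c := d) ih (hTp c)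
      ⟨?_, ?_, fun t ht htB => ?_, sum_extendCoeff_erase hu.dep hp hbT hcT hv
        (by rw [extendCoeff_right hpc hbc]; ring)⟩ ?_ (by simp) (by simp [hcd.symm, hdT]) ?_
    · intro t ht
      simp only [Finset.mem_insert] at ht
      rcases ht with rfl | rfl | ht
      · simp [hpc]
      · simp [hbc, hbT]
      · simp [(hne t ht).2.2, hB'T ht]
    · intro t ht
      simp only [Finset.mem_insert] at ht
      rcases ht with rfl | rfl | ht
      · rw [extendCoeff_self hpc hpb]
        have := mul_pos hγ hs
        linarith
      · rw [extendCoeff_left hpb hbc]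
        have := mul_pos hγ hs2
        linarith
      · obtain ⟨e1, e2, e3⟩ := hne t ht
        rw [extendCoeff_of_ne e1 e2 e3]; exact hu.pos t (by simp [ht])
    · simp only [Finset.mem_insert, not_or] at htB
      have htc := Finset.ne_of_mem_erase ht
      rw [extendCoeff_of_ne htB.1 htB.2.1 htc]
      refine hu.nonpos t ((Finset.mem_insert.1 (Finset.mem_of_mem_erase ht)).resolve_left htB.1) ?_
      simp [htB.2.1, htB.2.2, htc]
    · rw [Finset.card_insert_of_notMem (by simp [hpb, hpB']), Finset.card_insert_of_notMem hb', hB']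
    · rw [extendCoeff_self hpc hpb, extendCoeff_of_ne hpd.symm hbd.symm hcd.symm]
      linarith
  have β : altSum Ψ ((insert p T).erase b) (insert c B') = 0 := by
    have hr : 0 < u b / (1 - s) := by positivity
    refine ih _ _ (extendCoeff u p b c s (u b / (1 - s))) (hTp b)
      ⟨?_, ?_, fun t ht htB => ?_, sum_extendCoeff_erase hu.dep hp hbT hcT hv
        (by rw [extendCoeff_left hpb hbc, div_mul_cancel₀ _ hs2.ne', sub_self])⟩
      (by rw [Finset.card_insert_of_notMem hc', hB'])
    · intro t ht
      simp only [Finset.mem_insert] at ht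
      rcases ht with rfl | ht
      · simp [hbc.symm, hcT]
      · simp [(hne t ht).2.1, hB'T ht]
    · intro t ht
      simp only [Finset.mem_insert] at ht
      rcases ht with rfl | ht
      · rw [extendCoeff_right hpc hbc]; linarith
      · obtain ⟨e1, e2, e3⟩ := hne t ht
        rw [extendCoeff_of_ne e1 e2 e3]; exact hu.pos t (by simp [ht])
    · simp only [Finset.mem_insert, not_or] at htB
      have htb := Finset.ne_of_mem_erase ht
      by_cases htp : t = p
      · subst htp
        rw [extendCoeff_self hpc hpb]
        have := mul_pos hr hs
        linarith
      rw [extendCoeff_of_ne htp htb htB.1]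
      refine hu.nonpos t ((Finset.mem_insert.1 (Finset.mem_of_mem_erase ht)).resolve_left htp) ?_
      simp [htb, htB.1, htB.2]
  have key := h.swap_altSum hT hpM hp hbT hcT hbc hs hs1 hv hB'T hb' hc'
  rw [altSum_insert _ _ (by simp [hpb, hpB']), altSum_insert _ _ hb', altSum_insert _ _ hb',
    Finset.erase_right_comm (a := c) (b := p), Finset.erase_insert hp] at α
  rw [altSum_insert _ _ hc', Finset.erase_right_comm] at β
  rw [altSum_insert _ _ hb₁, altSum_insert _ _ hc', altSum_insert _ _ hc',
    Finset.erase_right_comm (a := b) (b := c)]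
  linear_combination (norm := module) key + α - β

/-- The Radon relations with at most two positive coefficients imply all of them. -/
theorem IsWeaklyAdditive.altSum_eq_zero (h : IsWeaklyAdditive v M Ψ) (n : ℕ) :
    ∀ (T B : Finset ι) (u : ι → ℝ), (T : Set ι) ⊆ M → IsDep v T B u → B.card = n + 1 →
      altSum Ψ T B = 0 := by
  induction n with
  | zero =>
    intro T B u hT hu hB
    obtain ⟨b, rfl⟩ := Finset.card_eq_one.1 hB
    rw [altSum_singleton, h.one T b u hT hu, sub_self]
  | succ n ih => exact fun T B u hT hu hB => h.altSum_succ ih hT hu hB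

end Extension

/-! ### Homogenisation of polytopes and full additivity of valuations -/

variable {d : ℕ}

/-- The embedding of `ℝᵈ` at height one. -/
def homog (a : Fin d → ℝ) : (Fin d → ℝ) × ℝ := (a, 1)

theorem inCone_homog {T : Finset (Fin d → ℝ)} {y : Fin d → ℝ} :
    InCone homog T (y, 1) ↔ y ∈ convexHull ℝ (T : Set (Fin d → ℝ)) := by
  rw [Finset.mem_convexHull']
  refine exists_congr fun c => and_congr Iff.rfl ?_
  simp [Prod.ext_iff, Prod.fst_sum, Prod.snd_sum, homog, and_comm]

theorem InCone.homog_height {T : Finset (Fin d → ℝ)} {y : Fin d → ℝ} {s : ℝ}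
    (h : InCone homog T (y, s)) : 0 ≤ s ∧ (s = 0 → y = 0) := by
  obtain ⟨c, hc, e⟩ := h
  simp only [Prod.ext_iff, Prod.fst_sum, Prod.snd_sum, homog, Prod.smul_mk, smul_eq_mul,
    mul_one] at e
  obtain ⟨rfl, rfl⟩ := e
  refine ⟨Finset.sum_nonneg hc, fun h0 => Finset.sum_eq_zero fun t ht => ?_⟩
  rw [(Finset.sum_eq_zero_iff_of_nonneg hc).1 h0 t ht, zero_smul]

theorem pointed_homog (T : Finset (Fin d → ℝ)) : Pointed homog T := by
  rintro ⟨y, s⟩ h1 h2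
  rw [Prod.neg_mk] at h2
  have hs : s = 0 := le_antisymm (by linarith [h2.homog_height.1]) h1.homog_height.1
  rw [h1.homog_height.2 hs, hs]; rfl

variable {L : AddSubgroup (Fin d → ℝ)} {G : Type*} [AddCommGroup G]

/-- The convex hull of a finite subset of `L`. -/
def hullPolytope (T : Finset (Fin d → ℝ)) (hT : (T : Set (Fin d → ℝ)) ⊆ L) : LPolytope L :=
  ⟨convexHull ℝ T, T, T.finite_toSet, hT, rfl⟩

theorem LPolytope.exists_eq_hull (P : LPolytope L) :
    ∃ T : Finset (Fin d → ℝ), (T : Set (Fin d → ℝ)) ⊆ L ∧ P.1 = convexHull ℝ T := by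
  obtain ⟨P, W, hW, hWL, rfl⟩ := P
  exact ⟨hW.toFinset, by simpa using hWL, by simp⟩

open Classical in
/-- The value of `φ` on the convex hull of `T`. -/
noncomputable def hullValue (φ : LPolytope L → G) (T : Finset (Fin d → ℝ)) : G :=
  if hT : (T : Set (Fin d → ℝ)) ⊆ L then φ (hullPolytope T hT) else 0

theorem hullValue_eq (φ : LPolytope L → G) {T : Finset (Fin d → ℝ)}
    (hT : (T : Set (Fin d → ℝ)) ⊆ L) {P : LPolytope L} (hP : P.1 = convexHull ℝ T) :
    hullValue φ T = φ P := by
  rw [hullValue, dif_pos hT]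
  congr 1
  exact Subtype.ext hP.symm

theorem hullValue_hull (φ : LPolytope L → G) {T : Finset (Fin d → ℝ)}
    (hT : (T : Set (Fin d → ℝ)) ⊆ L) : hullValue φ T = φ (hullPolytope T hT) :=
  hullValue_eq φ hT rfl

theorem linearCombination_sum_delta {ι κ M : Type*} [AddCommGroup M] (Ψ : Finset ι → M)
    (J : Finset κ) (z : κ → ℤ) (T : κ → Finset ι) (c : ℤ) (U : Finset ι) :
    Finsupp.linearCombination ℤ Ψ (∑ j ∈ J, z j • delta (T j) - c • delta U) =
      ∑ j ∈ J, z j • Ψ (T j) - c • Ψ U := by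
  simp only [map_sub, map_sum, map_smul, linearCombination_delta]

theorem coneInd_of_mem {ι E : Type*} [AddCommGroup E] [Module ℝ E] {v : ι → E} {y : E}
    {T : Finset ι} (h : InCone v T y) : coneInd v y T = 1 := by simp [coneInd, h]

theorem coneInd_of_notMem {ι E : Type*} [AddCommGroup E] [Module ℝ E] {v : ι → E} {y : E}
    {T : Finset ι} (h : ¬ InCone v T y) : coneInd v y T = 0 := by simp [coneInd, h]

/-- The points b + k(c - b), k a natural number, lie in any additive subgroup containing b and c.
They give s = 1/k, and all but finitely many avoid T. -/
theorem exists_extension_point [DecidableEq (Fin d → ℝ)] (T : Finset (Fin d → ℝ))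
    {b c : Fin d → ℝ} (hb : b ∈ L) (hc : c ∈ L) (hbc : b ≠ c) {ε : ℝ} (hε : 0 < ε) :
    ∃ p ∈ (L : Set (Fin d → ℝ)), p ∉ T ∧ ∃ s : ℝ, 0 < s ∧ s < ε ∧ s < 1 ∧
      homog c = s • homog p + (1 - s) • homog b := by
  obtain ⟨N, hN⟩ := exists_nat_gt (1 / ε)
  have hcb : c - b ≠ 0 := sub_ne_zero.2 hbc.symm
  have hinj : Function.Injective fun k : ℕ => b + (k : ℝ) • (c - b) := fun k l hkl => by
    have := smul_left_injective ℝ hcb (add_left_cancel hkl)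
    exact_mod_cast this
  obtain ⟨p, ⟨k, hk, rfl⟩, hp⟩ := ((Set.Ioi_infinite (N + 1)).image
    hinj.injOn).exists_notMem_finset T
  have hk1 : (N : ℝ) + 1 < k := by exact_mod_cast Set.mem_Ioi.1 hk
  have hN0 : (0 : ℝ) ≤ N := Nat.cast_nonneg N
  have hk0 : (0 : ℝ) < k := by linarith
  refine ⟨_, ?_, hp, 1 / (k : ℝ), by positivity, ?_, ?_, ?_⟩
  · change b + (k : ℝ) • (c - b) ∈ L
    rw [Nat.cast_smul_eq_nsmul]
    exact L.add_mem hb (L.nsmul_mem (L.sub_mem hc hb) k)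
  · rw [div_lt_iff₀ hk0]
    rw [div_lt_iff₀ hε] at hN
    nlinarith
  · rw [div_lt_one hk0]; linarith
  · refine Prod.ext ?_ ?_
    · simp only [homog, Prod.smul_mk, Prod.mk_add_mk]
      rw [smul_add, smul_smul, one_div_mul_cancel hk0.ne']
      module
    · simp [homog]

open Classical in
theorem IsLValuation.isWeaklyAdditive {φ : LPolytope L → G} (hφ : IsLValuation φ) :
    IsWeaklyAdditive homog (L : Set (Fin d → ℝ)) (hullValue φ) where
  extend T b hb c hc hbc ε hε := exists_extension_point T hb hc hbc hε
  -- The height coordinate of a dependence says that its coefficients sum to zero.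
  exists_neg T B u _ hu hB := by
    by_contra! hneg
    obtain ⟨b, hb⟩ := hB
    have h0 : ∑ t ∈ T, u t = 0 := by
      have := congrArg Prod.snd hu.dep
      simpa [Prod.snd_sum, homog] using this
    have := (Finset.sum_eq_zero_iff_of_nonneg hneg).1 h0 b (hu.sub hb)
    linarith [hu.pos b hb]
  one T b u hT hu := by
    have hTb : ((T.erase b : Finset _) : Set (Fin d → ℝ)) ⊆ L :=
      (Finset.coe_subset.2 (Finset.erase_subset b T)).trans hT
    rw [hullValue_eq φ hT (P := hullPolytope (T.erase b) hTb), hullValue_hull φ hTb]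
    ext y
    have := hu.altSum_coneInd (Finset.singleton_nonempty b) (y, 1)
    rw [altSum_singleton] at this
    change y ∈ convexHull ℝ _ ↔ _
    rw [← inCone_homog, ← inCone_homog]
    by_cases h1 : InCone homog T (y, 1) <;> by_cases h2 : InCone homog (T.erase b) (y, 1) <;>
      simp_all [coneInd]
  two T a b u hab hT hu := by
    have hsub : ∀ U ⊆ T, (U : Set (Fin d → ℝ)) ⊆ L :=
      fun U hU => (Finset.coe_subset.2 hU).trans hT
    have ha := hsub _ (Finset.erase_subset a T)
    have hb := hsub _ (Finset.erase_subset b T)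
    have hba := hsub _ ((Finset.erase_subset b _).trans (Finset.erase_subset a T))
    -- With two positive indices a and b, the Radon relation and monotonicity say that the hull of T
    -- is the union of the hulls of T \ {a} and T \ {b}, which meet in the hull of T \ {a, b}.
    have key : ∀ y : Fin d → ℝ, (InCone homog T (y, 1) ↔
        InCone homog (T.erase a) (y, 1) ∨ InCone homog (T.erase b) (y, 1)) ∧
        (InCone homog ((T.erase a).erase b) (y, 1) ↔
        InCone homog (T.erase a) (y, 1) ∧ InCone homog (T.erase b) (y, 1)) := fun y => by
      have h0 := hu.altSum_coneInd (Finset.insert_nonempty a {b}) (y, 1)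
      rw [altSum_pair _ _ hab] at h0
      have i1 : InCone homog (T.erase a) (y, 1) → InCone homog T (y, 1) :=
        fun h => h.mono (Finset.erase_subset _ _)
      have i2 : InCone homog (T.erase b) (y, 1) → InCone homog T (y, 1) :=
        fun h => h.mono (Finset.erase_subset _ _)
      have i3 : InCone homog ((T.erase a).erase b) (y, 1) → InCone homog (T.erase a) (y, 1) :=
        fun h => h.mono (Finset.erase_subset _ _)
      have i4 : InCone homog ((T.erase a).erase b) (y, 1) → InCone homog (T.erase b) (y, 1) :=
        fun h => h.mono (Finset.erase_subset_erase _ (Finset.erase_subset _ _))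
      by_cases h1 : InCone homog T (y, 1) <;>
      by_cases h2 : InCone homog (T.erase a) (y, 1) <;>
      by_cases h3 : InCone homog (T.erase b) (y, 1) <;>
      by_cases h4 : InCone homog ((T.erase a).erase b) (y, 1) <;>
      simp_all [coneInd]
    have hval := hφ.union (hullPolytope _ ha) (hullPolytope _ hb) (hullPolytope T hT)
      (hullPolytope _ hba) ?_ ?_
    · rw [altSum_pair _ _ hab, hullValue_hull φ hT, hullValue_hull φ ha, hullValue_hull φ hb,
        hullValue_hull φ hba, hval]
      abel
    · ext y
      have := (key y).1
      rwa [inCone_homog, inCone_homog, inCone_homog] at this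
    · ext y
      have := (key y).2
      rwa [inCone_homog, inCone_homog, inCone_homog] at this

open Classical in
/-- Full additivity: a linear relation among indicator functions of `Λ`-polytopes is inherited by
every `Λ`-valuation. -/
theorem IsLValuation.sum_eq_zero {φ : LPolytope L → G} (hφ : IsLValuation φ) {κ : Type*}
    (J : Finset κ) (z : κ → ℤ) (P : κ → LPolytope L)
    (h : ∀ y, ∑ j ∈ J, z j * (if y ∈ (P j).1 then 1 else 0) = 0) :
    ∑ j ∈ J, z j • φ (P j) = 0 := by
  choose T hTL hT using fun j => (P j).exists_eq_hull
  let V := J.biUnion T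
  have hTV : ∀ j ∈ J, T j ⊆ V := fun j hj => Finset.subset_biUnion_of_mem T hj
  have hVL : (V : Set (Fin d → ℝ)) ⊆ L := fun x hx => by
    obtain ⟨j, -, hj⟩ := Finset.mem_biUnion.1 (Finset.mem_coe.1 hx)
    exact hTL j hj
  -- All the cones contain the apex, so the relation may fail there. Subtracting copies of the cone
  -- {0} repairs this, at no cost because φ vanishes on the empty polytope.
  let n : Finset (Fin d → ℝ) →₀ ℤ := ∑ j ∈ J, z j • delta (T j) - (∑ j ∈ J, z j) • delta ∅
  have hn : n ∈ subsetSpan V :=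
    sub_mem (sum_mem fun j hj => Submodule.smul_mem _ _ (delta_mem (hTV j hj)))
      (Submodule.smul_mem _ _ (delta_mem (Finset.empty_subset _)))
  have hev : ∀ y, coneEval homog y n = 0 := by
    rintro ⟨y, s⟩
    rw [coneEval, linearCombination_sum_delta]
    rcases lt_trichotomy s 0 with hs | rfl | hs
    · have hz : ∀ U, coneInd homog (y, s) U = 0 := fun U =>
        coneInd_of_notMem fun hU => by linarith [hU.homog_height.1]
      simp [hz]
    · by_cases hy : y = 0
      · subst hy
        have hz : ∀ U : Finset (Fin d → ℝ), coneInd homog ((0 : Fin d → ℝ), (0 : ℝ)) U = 1 :=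
          fun U => coneInd_of_mem (InCone.zero _ _)
        simp [hz]
      · have hz : ∀ U, coneInd homog (y, (0 : ℝ)) U = 0 := fun U =>
          coneInd_of_notMem fun hU => hy (hU.homog_height.2 rfl)
        simp [hz]
    · have hcone : ∀ U, InCone homog U (y, s) ↔ s⁻¹ • y ∈ convexHull ℝ (U : Set (Fin d → ℝ)) := by
        intro U
        rw [← inCone_homog]
        constructor
        · intro hU
          simpa [hs.ne'] using hU.smul (inv_nonneg.2 hs.le)
        · intro hU
          simpa [hs.ne'] using hU.smul hs.le
      rw [← sub_eq_zero.2 (h (s⁻¹ • y))]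
      have h0 : coneInd homog (y, s) ∅ = 0 := coneInd_of_notMem fun hU => by simpa using (hcone ∅).1 hU
      rw [h0, smul_zero]
      congr 1
      refine Finset.sum_congr rfl fun j _ => ?_
      simp [coneInd, hcone, hT]
  have hmem := mem_radonSpan_of_coneEval V.card homog V n rfl (pointed_homog V) hn hev
  have hker : radonSpan homog V ≤ LinearMap.ker (Finsupp.linearCombination ℤ (hullValue φ)) := by
    refine Submodule.span_le.2 ?_
    rintro _ ⟨U, B, u, hU, hu, hB, rfl⟩
    obtain ⟨m, hm⟩ := Nat.exists_eq_succ_of_ne_zero (Finset.card_pos.2 hB).ne'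
    exact (linearCombination_altSum_delta _ _ _).trans
      (hφ.isWeaklyAdditive.altSum_eq_zero m U B u ((Finset.coe_subset.2 hU).trans hVL) hu hm)
  have h0 : Finsupp.linearCombination ℤ (hullValue φ) n = 0 := hker hmem
  have hempty : hullValue φ (∅ : Finset (Fin d → ℝ)) = 0 := by
    rw [hullValue_eq φ (by simp) (P := hullPolytope ∅ (by simp)) rfl]
    exact hφ.empty _ (by simp [hullPolytope])
  rw [linearCombination_sum_delta, hempty, smul_zero, sub_zero] at h0
  rw [← h0]
  exact Finset.sum_congr rfl fun j _ => by rw [hullValue_eq φ (hTL j) (hT j)]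

variable {d : ℕ} {L : AddSubgroup (Fin d → ℝ)} {G : Type*} [AddCommGroup G]

/-! ### The Cayley trick and vanishing of mixed valuations -/

section Mixed

variable {J : Type*}

/-- Minkowski sum of a family of `Λ`-polytopes over a finite set of indices. -/
def minkSum (P : J → LPolytope L) (I : Finset J) : LPolytope L :=
  ⟨∑ i ∈ I, (P i).1, IsLPolytope.sum I _ fun i _ => (P i).2⟩

/-- The combinatorial mixed valuation of a family indexed by a finite type. -/
def mixedValue [Fintype J] (φ : LPolytope L → G) (P : J → LPolytope L) : G :=
  ∑ I : Finset J, (-1 : ℤ) ^ (Fintype.card J - I.card) • φ (minkSum P I)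

/-- The terms of I and I ∪ {i} have opposite signs and, by translation invariance, equal values. -/
theorem IsLValuation.mixedValue_of_singleton [Fintype J] {φ : LPolytope L → G}
    (hφ : IsLValuation φ) {P : J → LPolytope L} {i : J} {t : Fin d → ℝ} (ht : t ∈ L)
    (hP : (P i).1 = {t}) : mixedValue φ P = 0 := by
  classical
  unfold mixedValue
  have hu : (Finset.univ : Finset (Finset J)) = (insert i (Finset.univ.erase i)).powerset := by
    rw [Finset.insert_erase (Finset.mem_univ i), Finset.powerset_univ]
  rw [hu, Finset.sum_powerset_insert (Finset.notMem_erase _ _), ← Finset.sum_add_distrib]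
  refine Finset.sum_eq_zero fun S hS => ?_
  have hiS : i ∉ S := fun h => by simpa using Finset.mem_powerset.1 hS h
  have hval : φ (minkSum P (insert i S)) = φ (minkSum P S) := by
    refine hφ.translate _ _ t ht ?_
    change ∑ j ∈ insert i S, (P j).1 = (fun x => x + t) '' ∑ j ∈ S, (P j).1
    rw [Finset.sum_insert hiS, hP, add_comm, Set.add_singleton]
  have hcard : S.card < Fintype.card J := by
    rw [← Finset.card_univ]
    exact Finset.card_lt_card ⟨Finset.subset_univ S, fun h => hiS (h (Finset.mem_univ i))⟩
  rw [hval, Finset.card_insert_of_notMem hiS, ← add_smul,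
    show Fintype.card J - S.card = Fintype.card J - (S.card + 1) + 1 by omega, pow_succ]
  simp

variable [DecidableEq J]

open Classical in
/-- The points of colour `i` in a finite coloured point set. -/
noncomputable def colorClass (T : Finset (J × (Fin d → ℝ))) (i : J) : Finset (Fin d → ℝ) :=
  (T.filter fun x => x.1 = i).image Prod.snd

theorem mem_colorClass {T : Finset (J × (Fin d → ℝ))} {i : J} {a : Fin d → ℝ} :
    a ∈ colorClass T i ↔ (i, a) ∈ T := by
  simp [colorClass]

/-- The Cayley embedding of a coloured point. -/
def cayley (x : J × (Fin d → ℝ)) : (Fin d → ℝ) × (J → ℝ) := (x.2, Pi.single x.1 1)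

variable [Fintype J]

theorem sum_colorClass {M : Type*} [AddCommMonoid M] (T : Finset (J × (Fin d → ℝ)))
    (f : J × (Fin d → ℝ) → M) :
    ∑ x ∈ T, f x = ∑ i, ∑ a ∈ colorClass T i, f (i, a) :=
  Finset.sum_finset_product T Finset.univ (colorClass T) fun x => by simp [mem_colorClass]

theorem sum_smul_cayley (T : Finset (J × (Fin d → ℝ))) (c : J × (Fin d → ℝ) → ℝ) :
    ∑ x ∈ T, c x • cayley x = (∑ i, ∑ a ∈ colorClass T i, c (i, a) • a,
      fun i => ∑ a ∈ colorClass T i, c (i, a)) := by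
  rw [sum_colorClass]
  refine Prod.ext ?_ ?_
  · simp [Prod.fst_sum, cayley]
  · funext j
    simp only [Prod.snd_sum, cayley, Prod.smul_mk, Finset.sum_apply, Pi.smul_apply, smul_eq_mul]
    rw [Finset.sum_eq_single j (fun i _ hij => Finset.sum_eq_zero fun a _ => by
      rw [Pi.single_eq_of_ne hij.symm, mul_zero]) (by simp)]
    simp

/-- The Cayley trick. -/
theorem inCone_cayley {T : Finset (J × (Fin d → ℝ))} {I : Finset J} {y : Fin d → ℝ} :
    InCone cayley T (y, fun i => if i ∈ I then 1 else 0) ↔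
      y ∈ ∑ i ∈ I, convexHull ℝ (colorClass T i : Set (Fin d → ℝ)) := by
  rw [Set.mem_finsetSum]
  constructor
  · rintro ⟨c, hc, e⟩
    rw [sum_smul_cayley] at e
    obtain ⟨e1, e2⟩ := Prod.mk.inj e
    have hc' : ∀ i, ∀ a ∈ colorClass T i, 0 ≤ c (i, a) := fun i a ha => hc _ (mem_colorClass.1 ha)
    refine ⟨fun i => ∑ a ∈ colorClass T i, c (i, a) • a, fun {i} hi => ?_, ?_⟩
    · rw [Finset.mem_convexHull']
      refine ⟨fun a => c (i, a), hc' i, ?_, rfl⟩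
      simpa [hi] using congrFun e2 i
    · rw [← e1]
      refine Finset.sum_subset (Finset.subset_univ I) fun i _ hi => ?_
      have h0 : ∑ a ∈ colorClass T i, c (i, a) = 0 := by simpa [hi] using congrFun e2 i
      refine Finset.sum_eq_zero fun a ha => ?_
      rw [(Finset.sum_eq_zero_iff_of_nonneg (hc' i)).1 h0 a ha, zero_smul]
  · rintro ⟨g, hg, rfl⟩
    have hg' : ∀ i ∈ I, ∃ w : (Fin d → ℝ) → ℝ, (∀ a ∈ colorClass T i, 0 ≤ w a) ∧
        ∑ a ∈ colorClass T i, w a = 1 ∧ ∑ a ∈ colorClass T i, w a • a = g i :=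
      fun i hi => Finset.mem_convexHull'.1 (hg hi)
    choose! w hw0 hw1 hw using hg'
    refine ⟨fun x => if x.1 ∈ I then w x.1 x.2 else 0, fun x hx => ?_, ?_⟩
    · dsimp only
      split_ifs with h
      · exact hw0 x.1 h x.2 (mem_colorClass.2 hx)
      · exact le_rfl
    · rw [sum_smul_cayley]
      refine Prod.ext ?_ ?_
      · dsimp only
        rw [← Finset.sum_subset (Finset.subset_univ I) fun i _ hi => by simp [hi]]
        exact Finset.sum_congr rfl fun i hi => by simpa [hi] using hw i hi
      · funext i
        by_cases hi : i ∈ I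
        · simpa [hi] using hw1 i hi
        · simp [hi]

/-- The convex hulls of the colour classes. -/
noncomputable def colorPolytope (T : Finset (J × (Fin d → ℝ))) (hT : ∀ x ∈ T, x.2 ∈ L) (i : J) :
    LPolytope L :=
  hullPolytope (colorClass T i) fun _ ha => hT _ (mem_colorClass.1 (Finset.mem_coe.1 ha))

open Classical in
/-- The mixed value of the colour classes. -/
noncomputable def colorValue (φ : LPolytope L → G) (T : Finset (J × (Fin d → ℝ))) : G :=
  if hT : ∀ x ∈ T, x.2 ∈ L then mixedValue φ (colorPolytope T hT) else 0

open Classical in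
-- For each I, the slice of the Radon relation over the indicator vector of I is a relation between
-- indicators of Minkowski sums, by the Cayley trick. Full additivity transfers it to φ.
theorem IsLValuation.altSum_colorValue {φ : LPolytope L → G} (hφ : IsLValuation φ)
    {T B : Finset (J × (Fin d → ℝ))} {u : J × (Fin d → ℝ) → ℝ} (hT : ∀ x ∈ T, x.2 ∈ L)
    (hu : IsDep cayley T B u) (hB : B.Nonempty) : altSum (colorValue φ) T B = 0 := by
  have hTS : ∀ S, ∀ x ∈ T \ S, x.2 ∈ L := fun S x hx => hT x (Finset.mem_sdiff.1 hx).1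
  have hI : ∀ I : Finset J, ∑ S ∈ B.powerset,
      (-1 : ℤ) ^ S.card • φ (minkSum (colorPolytope (T \ S) (hTS S)) I) = 0 := fun I => by
    refine hφ.sum_eq_zero B.powerset (fun S => (-1 : ℤ) ^ S.card)
      (fun S => minkSum (colorPolytope (T \ S) (hTS S)) I) fun y => ?_
    have h0 := hu.altSum_coneInd hB (y, fun i => if i ∈ I then 1 else 0)
    refine Eq.trans ?_ h0
    refine Finset.sum_congr rfl fun S _ => ?_
    rw [smul_eq_mul, coneInd]
    simp only [inCone_cayley]
    rfl
  have hS : ∀ S, colorValue φ (T \ S) = mixedValue φ (colorPolytope (T \ S) (hTS S)) :=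
    fun S => dif_pos (hTS S)
  simp only [altSum, hS, mixedValue, Finset.smul_sum]
  rw [Finset.sum_comm]
  refine Finset.sum_eq_zero fun I _ => ?_
  simp only [smul_comm _ ((-1 : ℤ) ^ (Fintype.card J - I.card))]
  rw [← Finset.smul_sum, hI I, smul_zero]

theorem IsLValuation.colorValue_eq_zero {φ : LPolytope L → G} (hφ : IsLValuation φ)
    (hd : d < Fintype.card J) (T : Finset (J × (Fin d → ℝ))) (hT : ∀ x ∈ T, x.2 ∈ L)
    (hne : ∀ i, (colorClass T i).Nonempty) : colorValue φ T = 0 := by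
  classical
  induction T using Finset.strongInduction with
  | H T ih =>
  by_cases h1 : ∃ i, (colorClass T i).card ≤ 1
  · obtain ⟨i, hi⟩ := h1
    obtain ⟨t, ht⟩ := Finset.card_eq_one.1 (le_antisymm hi (Finset.card_pos.2 (hne i)))
    have htL : t ∈ L := hT (i, t) (mem_colorClass.1 (by rw [ht]; simp))
    rw [colorValue, dif_pos hT]
    refine hφ.mixedValue_of_singleton (i := i) htL ?_
    simp [colorPolytope, hullPolytope, ht]
  · push Not at h1
    have hcard : T.card = ∑ i, (colorClass T i).card := by
      simpa using sum_colorClass T fun _ => (1 : ℕ)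
    have hcard2 : Fintype.card J * 2 ≤ T.card := by
      rw [hcard]
      have := Finset.card_nsmul_le_sum Finset.univ (fun i => (colorClass T i).card) 2
        fun i _ => h1 i
      simpa [Finset.card_univ] using this
    -- At least 2|J| Cayley vectors lie in a space of dimension d + |J| < 2|J|.
    have hli : ¬ LinearIndepOn ℝ cayley (T : Set (J × (Fin d → ℝ))) := fun hli => by
      have := LinearIndependent.fintype_card_le_finrank hli
      simp at this
      omega
    rw [linearIndepOn_finset_iff] at hli
    push Not at hli
    obtain ⟨f, hf, t₀, ht₀, h0⟩ := hli
    obtain ⟨B, u, hu, hB⟩ := exists_isDep hf ht₀ h0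
    have key := hφ.altSum_colorValue hT hu hB
    rw [altSum, Finset.sum_eq_single ∅] at key
    · simpa using key
    · intro S hS hS0
      have hSB := Finset.mem_powerset.1 hS
      rw [ih (T \ S) (Finset.sdiff_ssubset (hSB.trans hu.sub) (Finset.nonempty_iff_ne_empty.2 hS0))
        (fun x hx => hT x (Finset.mem_sdiff.1 hx).1) fun i => ?_, smul_zero]
      -- Deleting S cannot exhaust a colour: the coefficients of u on each colour sum to zero, so
      -- they cannot all be positive.
      by_contra hem
      rw [Finset.not_nonempty_iff_eq_empty] at hem
      have hall : ∀ a ∈ colorClass T i, 0 < u (i, a) := fun a ha => by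
        refine hu.pos _ (hSB ?_)
        by_contra haS
        have : a ∈ colorClass (T \ S) i :=
          mem_colorClass.2 (Finset.mem_sdiff.2 ⟨mem_colorClass.1 ha, haS⟩)
        rw [hem] at this
        simp at this
      have hdep := hu.dep
      rw [sum_smul_cayley] at hdep
      have hz : ∑ a ∈ colorClass T i, u (i, a) = 0 := congrFun (congrArg Prod.snd hdep) i
      exact (Finset.sum_pos hall (hne i)).ne' hz
    · simp

/-- The combinatorial mixed valuations of order greater than the dimension vanish. -/
theorem IsLValuation.mixedValue_eq_zero {φ : LPolytope L → G} (hφ : IsLValuation φ)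
    (hd : d < Fintype.card J) (P : J → LPolytope L) (hP : ∀ i, (P i).1.Nonempty) :
    mixedValue φ P = 0 := by
  classical
  choose W hWL hW using fun i => (P i).exists_eq_hull
  let T : Finset (J × (Fin d → ℝ)) := Finset.univ.biUnion fun i => (W i).image (Prod.mk i)
  have hmem : ∀ i a, (i, a) ∈ T ↔ a ∈ W i := fun i a => by simp [T]
  have hclass : ∀ i, colorClass T i = W i := fun i => by
    ext a; rw [mem_colorClass, hmem]
  have hT : ∀ x ∈ T, x.2 ∈ L := fun x hx => hWL x.1 (Finset.mem_coe.2 ((hmem x.1 x.2).1 hx))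
  have hPT : colorPolytope T hT = P := by
    funext i
    refine Subtype.ext ?_
    rw [hW i, ← hclass i]; rfl
  have h0 := hφ.colorValue_eq_zero hd T hT fun i => by
    have := hP i
    rw [hW i, convexHull_nonempty_iff] at this
    rw [hclass i]; exact this
  rwa [colorValue, dif_pos hT, hPT] at h0

end Mixed

/-! ### Newton expansion in several variables -/

section Binomial

open MvPolynomial

variable {r : ℕ} {G : Type*} [AddCommGroup G]

/-- The linear functional on polynomials sending the monomial with exponent `n` to `f n`. -/
noncomputable def umbral (f : (Fin r → ℕ) → G) : MvPolynomial (Fin r) ℤ →ₗ[ℤ] G :=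
  (basisMonomials (Fin r) ℤ).constr ℤ fun n => f n

theorem umbral_monomial (f : (Fin r → ℕ) → G) (n : Fin r →₀ ℕ) :
    umbral f (monomial n 1) = f n := by
  have := (basisMonomials (Fin r) ℤ).constr_basis ℤ (fun n => f n) n
  rwa [coe_basisMonomials] at this

theorem umbral_prod_X_pow (f : (Fin r → ℕ) → G) (n : Fin r → ℕ) :
    umbral f (∏ i, X i ^ n i) = f n := by
  have : (∏ i, X i ^ n i : MvPolynomial (Fin r) ℤ) =
      monomial (Finsupp.equivFunOnFinite.symm n) 1 := by
    rw [monomial_eq, Finsupp.prod_fintype _ _ (by simp)]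
    simp
  rw [this, umbral_monomial]
  rfl

/-- The mixed finite difference of `f` of order `α` at the origin. -/
noncomputable def mixedDiff (f : (Fin r → ℕ) → G) (α : Fin r → ℕ) : G :=
  umbral f (∏ i, (X i - 1) ^ α i)

theorem prod_add_one_pow {R : Type*} [CommRing R] (x : Fin r → R) (n : Fin r → ℕ) :
    ∏ i, (x i + 1) ^ n i = ∑ α ∈ Fintype.piFinset fun i => Finset.range (n i + 1),
      (∏ i, (n i).choose (α i)) • ∏ i, x i ^ α i := by
  simp only [add_pow, one_pow, mul_one]
  rw [Finset.prod_univ_sum]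
  refine Finset.sum_congr rfl fun α _ => ?_
  rw [Finset.prod_mul_distrib, nsmul_eq_mul, Nat.cast_prod, mul_comm]

/-- Newton's expansion. -/
theorem eq_sum_mixedDiff (f : (Fin r → ℕ) → G) (n : Fin r → ℕ) :
    f n = ∑ α ∈ Fintype.piFinset fun i => Finset.range (n i + 1),
      (∏ i, (n i).choose (α i)) • mixedDiff f α := by
  have h := prod_add_one_pow (fun i => (X i - 1 : MvPolynomial (Fin r) ℤ)) n
  simp only [sub_add_cancel] at h
  rw [← umbral_prod_X_pow f n, h, map_sum]
  simp only [map_nsmul, mixedDiff]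

theorem prod_choose_eq_zero {n α : Fin r → ℕ}
    (h : α ∉ Fintype.piFinset fun i => Finset.range (n i + 1)) :
    ∏ i, (n i).choose (α i) = 0 := by
  simp only [Fintype.mem_piFinset, Finset.mem_range, not_forall, not_lt] at h
  obtain ⟨i, hi⟩ := h
  exact Finset.prod_eq_zero (Finset.mem_univ i) (Nat.choose_eq_zero_of_lt hi)

theorem sum_choose_smul (c : (Fin r → ℕ) →₀ G) (n : Fin r → ℕ) :
    (c.sum fun α g => (∏ i, (n i).choose (α i)) • g) =
      ∑ α ∈ Fintype.piFinset fun i => Finset.range (n i + 1),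
        (∏ i, (n i).choose (α i)) • c α := by
  classical
  rw [Finsupp.sum, Finset.sum_subset (Finset.subset_union_left
    (s₂ := Fintype.piFinset fun i => Finset.range (n i + 1)))]
  · symm
    refine Finset.sum_subset Finset.subset_union_right fun α _ hα => ?_
    rw [prod_choose_eq_zero hα, zero_smul]
  · intro α _ hα
    rw [Finsupp.notMem_support_iff.1 hα, smul_zero]

/-- An expansion says that `umbral f` is `umbral c` after the substitution X ↦ X + 1, which sends ∏
(X i - 1)^α i to the monomial of exponent α. This gives uniqueness and identifies the coefficients.
-/
theorem IsBinomialExpansion.eq_mixedDiff {f : (Fin r → ℕ) → G} {c : (Fin r → ℕ) →₀ G}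
    (h : IsBinomialExpansion f c) (α : Fin r → ℕ) : c α = mixedDiff f α := by
  let σ : MvPolynomial (Fin r) ℤ →ₐ[ℤ] MvPolynomial (Fin r) ℤ := aeval fun i => X i + 1
  have hf : umbral f = umbral c ∘ₗ σ.toLinearMap := by
    refine (basisMonomials (Fin r) ℤ).ext fun n => ?_
    rw [coe_basisMonomials, umbral_monomial, h n, LinearMap.comp_apply]
    have : σ.toLinearMap (monomial n 1) = ∏ i, (X i + 1) ^ n i := by
      simp only [AlgHom.toLinearMap_apply, σ, aeval_monomial, map_one, one_mul]
      exact Finsupp.prod_fintype _ _ (by simp)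
    rw [this, prod_add_one_pow, map_sum]
    simp only [map_nsmul, umbral_prod_X_pow]
    exact sum_choose_smul c n
  rw [mixedDiff, hf, LinearMap.comp_apply]
  simp [σ, umbral_prod_X_pow]

/-- A function whose mixed differences of total order greater than `D` vanish has a finite binomial
expansion. -/
theorem exists_isBinomialExpansion {f : (Fin r → ℕ) → G} {D : ℕ}
    (h : ∀ α : Fin r → ℕ, D < ∑ i, α i → mixedDiff f α = 0) :
    ∃ c, IsBinomialExpansion f c := by
  refine ⟨Finsupp.onFinset (Fintype.piFinset fun _ => Finset.range (D + 1)) (mixedDiff f)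
    fun α hα => ?_, fun n => ?_⟩
  · simp only [Fintype.mem_piFinset, Finset.mem_range, Nat.lt_succ_iff]
    intro i
    by_contra! hi
    exact hα (h α (hi.trans_le (Finset.single_le_sum (fun _ _ => Nat.zero_le _)
      (Finset.mem_univ i))))
  · rw [sum_choose_smul]
    exact eq_sum_mixedDiff f n

end Binomial

/-! ### Mixed differences of Minkowski combinations -/

section Dilates

open MvPolynomial

variable {d r : ℕ} {L : AddSubgroup (Fin d → ℝ)} {G : Type*} [AddCommGroup G]

/-- Convexity gives (m + n)P = mP + nP, and nonemptiness gives 0P = {0}. -/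
theorem natComb_add_single {P : Fin r → LPolytope L} (hP : ∀ i, (P i).1.Nonempty) (n : Fin r →₀ ℕ)
    (j : Fin r) : (natComb P (n + Finsupp.single j 1 : Fin r →₀ ℕ)).1 =
      (P j).1 + (natComb P n).1 := by
  have hconv : ∀ i, Convex ℝ (P i).1 := fun i => by
    obtain ⟨V, -, -, hV⟩ := (P i).2
    rw [hV]
    exact convex_convexHull ℝ V
  simp only [natComb, Finsupp.add_apply, Nat.cast_add]
  rw [Finset.sum_congr rfl fun i _ => (hconv i).add_smul (Nat.cast_nonneg (n i))
    (Nat.cast_nonneg (Finsupp.single j 1 i)), Finset.sum_add_distrib, add_comm]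
  congr 1
  rw [Finset.sum_eq_single j (fun i _ hij => by
    rw [Finsupp.single_eq_of_ne hij, Nat.cast_zero, Set.zero_smul_set (hP i)]) (by simp)]
  simp

theorem natComb_sum_single {J : Type*} {P : Fin r → LPolytope L} (hP : ∀ i, (P i).1.Nonempty)
    (κ : J → Fin r) (I : Finset J) :
    natComb P (∑ x ∈ I, Finsupp.single (κ x) 1 : Fin r →₀ ℕ) = minkSum (fun x => P (κ x)) I := by
  classical
  refine Subtype.ext ?_
  induction I using Finset.induction_on with
  | empty =>
    simp only [natComb, minkSum, Finset.sum_empty, Finsupp.coe_zero, Pi.zero_apply, Nat.cast_zero]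
    exact Finset.sum_eq_zero fun i _ => Set.zero_smul_set (hP i)
  | insert x I hx ih =>
    rw [Finset.sum_insert hx, add_comm, natComb_add_single hP, ih]
    simp only [minkSum]
    rw [Finset.sum_insert hx]

/-- Expanding the product over subsets of J reproduces the alternating sum defining the mixed value.
Since κ may repeat indices, this covers differences of every order. -/
theorem umbral_prod_X_sub_one {J : Type*} [Fintype J] (φ : LPolytope L → G)
    {P : Fin r → LPolytope L} (hP : ∀ i, (P i).1.Nonempty) (κ : J → Fin r) :
    umbral (fun n => φ (natComb P n)) (∏ x, (X (κ x) - 1)) = mixedValue φ fun x => P (κ x) := by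
  classical
  simp only [sub_eq_add_neg]
  rw [Finset.prod_add, map_sum, Finset.powerset_univ]
  refine Finset.sum_congr rfl fun I _ => ?_
  have hX : (∏ x ∈ I, X (κ x) : MvPolynomial (Fin r) ℤ) =
      monomial (∑ x ∈ I, Finsupp.single (κ x) 1) 1 := by
    rw [monomial_sum_one]; rfl
  have hs : ((∏ x ∈ I, X (κ x)) * ∏ x ∈ Finset.univ \ I, (-1) : MvPolynomial (Fin r) ℤ) =
      (-1 : ℤ) ^ (Fintype.card J - I.card) • ∏ x ∈ I, X (κ x) := by
    rw [Finset.prod_const, ← Finset.compl_eq_univ_sdiff, Finset.card_compl, mul_comm, zsmul_eq_mul]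
    simp
  rw [hs, map_smul, hX, umbral_monomial, natComb_sum_single hP]

theorem mixedDiff_natComb (φ : LPolytope L → G) {P : Fin r → LPolytope L}
    (hP : ∀ i, (P i).1.Nonempty) (α : Fin r → ℕ) :
    mixedDiff (fun n => φ (natComb P n)) α =
      mixedValue φ fun x : (i : Fin r) × Fin (α i) => P x.1 := by
  rw [← umbral_prod_X_sub_one φ hP, mixedDiff, Fintype.prod_sigma]
  simp

theorem CM_eq_mixedValue (φ : LPolytope L → G) (P : Fin r → LPolytope L) :
    CM φ P = mixedValue φ P := by
  simp only [CM, mixedValue, Fintype.card_fin]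
  rfl

theorem mixedDiff_natComb_one (φ : LPolytope L → G) {P : Fin r → LPolytope L}
    (hP : ∀ i, (P i).1.Nonempty) :
    mixedDiff (fun n => φ (natComb P n)) (fun _ => 1) = CM φ P := by
  rw [CM_eq_mixedValue]
  refine Eq.trans ?_ (umbral_prod_X_sub_one φ hP id)
  simp [mixedDiff]

end Dilates
end CombMixed

/-- Polynomiality of Minkowski combinations and vanishing of the combinatorial mixed valuations.
The proof works for an arbitrary additive subgroup of `ℝᵈ`, so that `hL` is not needed. -/
theorem mainTheorem9 {d : ℕ} (L : AddSubgroup (Fin d → ℝ)) (hL : CombMixed.IsLatticeOrSubspace L)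
    {G : Type*} [AddCommGroup G] (φ : CombMixed.LPolytope L → G)
    (hφ : CombMixed.IsLValuation φ) :
    (∀ (r : ℕ) (P : Fin r → CombMixed.LPolytope L), (∀ i, (P i).1.Nonempty) →
      ∃ c : (Fin r → ℕ) →₀ G,
        CombMixed.IsBinomialExpansion (fun n => φ (CombMixed.natComb P n)) c ∧
        (∀ c' : (Fin r → ℕ) →₀ G,
          CombMixed.IsBinomialExpansion (fun n => φ (CombMixed.natComb P n)) c' → c' = c) ∧
        c (fun _ => 1) = CombMixed.CM φ P) ∧
    (∀ (r : ℕ), d < r → ∀ P : Fin r → CombMixed.LPolytope L, (∀ i, (P i).1.Nonempty) →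
      CombMixed.CM φ P = 0) := by
  refine ⟨fun r P hP => ?_, fun r hr P hP => ?_⟩
  -- A difference of order α is a mixed value of |α| polytopes, so the vanishing theorem bounds the
  -- total degree by d.
  · obtain ⟨c, hc⟩ := CombMixed.exists_isBinomialExpansion (D := d)
      (f := fun n => φ (CombMixed.natComb P n)) fun α hα => by
        rw [CombMixed.mixedDiff_natComb φ hP]
        exact hφ.mixedValue_eq_zero (by simpa using hα) _ fun x => hP x.1
    refine ⟨c, hc, fun c' hc' => Finsupp.ext fun α => ?_, ?_⟩
    · rw [hc.eq_mixedDiff, hc'.eq_mixedDiff]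
    · rw [hc.eq_mixedDiff, CombMixed.mixedDiff_natComb_one φ hP]
  · rw [CombMixed.CM_eq_mixedValue]
    exact hφ.mixedValue_eq_zero (by simpa using hr) P hP
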